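/- Let $\mathcal N$ be a separable complex Hilbert space with inner product $(\cdot,\cdot)_{\mathcal N}$ (linear in the second factor), let $\{u_n\}_{n\in\mathcal I}$, $\mathcal I\subseteq\mathbb N$, be a complete orthonormal system in $\mathcal N$, and let $\widetilde\Omega$ be a positive $\mathcal B(\mathcal N)$-valued measure on the Borel sets of $\mathbb R$, countably additive in the strong operator topology, such that $$\widetilde\Omega(\mathbb R)=I_{\mathcal N},\qquad \int_{\mathbb R}(1+\lambda^2)\,d(\xi,\widetilde\Omega(\lambda)\xi)_{\mathcal N}=\infty\quad\text{for all }\xi\in\mathcal N\setminus\{0\}$$ (equivalently, with $d\Omega=(1+\lambda^2)\,d\widetilde\Omega$: $\int_{\mathbb R}(1+\lambda^2)^{-1}d\Omega=I_{\mathcal N}$ and $\int_{\mathbb R}d(\xi,\Omega\xi)_{\mathcal N}=\infty$ for $\xi\neq0$). *The model space.* Put $\tilde\mu(B)=\sum_{n\in\mathcal I}2^{-n}(u_n,\widetilde\Omega(B)u_n)_{\mathcal N}$ and let $\phi_{m,n}$ be the Radon–Nikodym derivative of $(u_m,\widetilde\Omega(\cdot)u_n)_{\mathcal N}$ with respect to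 $\tilde\mu$. For $\tilde\mu$-a.e. $\lambda$ the matrix $(\phi_{m,n}(\lambda))$ is positive semidefinite; let $\mathcal N_\lambda$ be the Hilbert space obtained from $\mathcal V=\operatorname{lin.span}\{u_n\}_{n\in\mathcal I}$ with the semi-inner product $(\sum_m\alpha_mu_m,\sum_n\beta_nu_n)_\lambda=\sum_{m,n}\phi_{m,n}(\lambda)\overline{\alpha_m}\beta_n$ by dividing out null vectors and completing (and $\mathcal N_\lambda=\{0\}$ on the exceptional null set). A section $\lambda\mapsto f(\lambda)\in\mathcal N_\lambda$ is measurable if $\lambda\mapsto(u_n,f(\lambda))_{\mathcal N_\lambda}$ is $\tilde\mu$-measurable for every $n$. For a weight $w>0$, $L^2(\mathbb R,\mathcal N;w\,d\widetilde\Omega)$ is the Hilbert space of measurable sections with $\int_{\mathbb R}w\,\|f(\lambda)\|_{\mathcal N_\lambda}^2\,d\tilde\mu(\lambda)<\infty$, modulo equality $\tilde\mu$-a.e., with the inner product $\int_{\mathbb R}w\,(f(\lambda),g(\lambda))_{\mathcal N_\lambda}\,d\tilde\mu(\lambda)$. Let $\underline\Lambda:\mathcal N\to L^2(\mathbb R,\mathcal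 N;d\widetilde\Omega)$ be the bounded operator extending the map that sends $v\in\mathcal V$ to the constant section $\lambda\mapsto v$. *The operators.* Let $\widehat{\mathcal H}=L^2(\mathbb R,\mathcal N;d\Omega)=L^2(\mathbb R,\mathcal N;(1+\lambda^2)\,d\widetilde\Omega)$, let $\widehat H$ be the operator of multiplication by $\lambda$ in $\widehat{\mathcal H}$ with domain $\operatorname{dom}(\widehat H)=L^2(\mathbb R,\mathcal N;(1+\lambda^2)\,d\Omega)$, and let $\widehat{\dot H}$ be the restriction of $\widehat H$ to $$\operatorname{dom}(\widehat{\dot H})=\Big\{\hat f\in\operatorname{dom}(\widehat H)\ \Big|\ \int_{\mathbb R}(1+\lambda^2)\,(\underline\xi(\lambda),\hat f(\lambda))_{\mathcal N_\lambda}\,d\tilde\mu(\lambda)=0\ \text{ for all }\underline\xi\in\underline\Lambda(\mathcal N)\Big\}.$$ **Theorem.** The operator $\widehat{\dot H}$ is densely defined, symmetric and closed in $\widehat{\mathcal H}$. Its deficiency indices are $\big(\dim\ker(\widehat{\dot H}^*-i),\dim\ker(\widehat{\dot H}^*+i)\big)=(k,k)$ with $k=\dim_{\mathbb C}(\mathcal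 N)\in\mathbb N\cup\{\infty\}$ (here $0\in\mathbb N$), and for every $z\in\mathbb C\setminus\mathbb R$ $$\ker(\widehat{\dot H}^*-z)=\overline{\operatorname{lin.span}\big\{\{(\lambda-z)^{-1}u_n\}_{\lambda\in\mathbb R}\in\widehat{\mathcal H}\ \big|\ n\in\mathcal I\big\}}.$$ -/

import Mathlib

open MeasureTheory Filter Topology
open scoped ENNReal InnerProductSpace ComplexConjugate ComplexOrder

/-- A measurable family of Hilbert spaces `K t`, `t ∈ ℝ`, modelled on `μ`, presented by a countable
generating family of sections `e n` with measurable mutual inner products and fibrewise dense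
linear span. -/
structure MeasurableField (ι : Type*) (K : ℝ → Type*) [∀ t, NormedAddCommGroup (K t)]
    [∀ t, InnerProductSpace ℂ (K t)] (μ : Measure ℝ) where
  e : ι → ∀ t, K t
  aemeasurable_inner : ∀ m n, AEMeasurable (fun t => ⟪e m t, e n t⟫_ℂ) μ
  dense_span : ∀ᵐ t ∂μ, Dense (Submodule.span ℂ (Set.range fun n => e n t) : Set (K t))

namespace MeasurableField

variable {ι : Type*} {K : ℝ → Type*} [∀ t, NormedAddCommGroup (K t)]
  [∀ t, InnerProductSpace ℂ (K t)] {μ : Measure ℝ}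

/-- The measurable sections: those `f` with `(e n, f)` measurable for all `n`. -/
def sections (M : MeasurableField ι K μ) : Submodule ℂ (∀ t, K t) where
  carrier := {f | ∀ n, AEMeasurable (fun t => ⟪M.e n t, f t⟫_ℂ) μ}
  add_mem' := by
    intro f g hf hg n
    simpa only [Pi.add_apply, inner_add_right] using! (hf n).add (hg n)
  zero_mem' := by
    intro n
    simp
  smul_mem' := by
    intro c f hf n
    simpa only [Pi.smul_apply, inner_smul_right] using! (hf n).const_mul c

/-- The same generating family, over an absolutely continuous measure. -/
def mono (M : MeasurableField ι K μ) {ν : Measure ℝ} (h : ν ≪ μ) :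
    MeasurableField ι K ν where
  e := M.e
  aemeasurable_inner m n := (M.aemeasurable_inner m n).mono_ac h
  dense_span := h.ae_le M.dense_span

/-- A countable dense set of combinations of the generating sections. -/
noncomputable def approx (M : MeasurableField ι K μ) (p : Finset ι × ℕ) (t : ℝ) : K t :=
  ∑ i : p.1, TopologicalSpace.denseSeq (p.1 → ℂ) p.2 i • M.e i t

theorem dense_approx (M : MeasurableField ι K μ) (t : ℝ)
    (h : Dense (Submodule.span ℂ (Set.range fun n => M.e n t) : Set (K t))) :
    DenseRange fun p => M.approx p t := by
  classical
  intro x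
  have key : (Submodule.span ℂ (Set.range fun n => M.e n t) : Set (K t)) ⊆
      closure (Set.range fun p => M.approx p t) := by
    intro y hy
    rw [SetLike.mem_coe, Finsupp.mem_span_range_iff_exists_finsupp] at hy
    obtain ⟨c, rfl⟩ := hy
    let L : (c.support → ℂ) → K t := fun a => ∑ i : c.support, a i • M.e i t
    have hL : Continuous L := by fun_prop
    have h1 : L (fun i => c i) ∈ closure (Set.range (L ∘ TopologicalSpace.denseSeq _)) := by
      exact (hL.range_subset_closure_image_dense
        (TopologicalSpace.denseRange_denseSeq (c.support → ℂ))).trans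
        (by rw [← Set.range_comp]) ⟨_, rfl⟩
    have h2 : L (fun i => c i) = c.sum fun i a => a • M.e i t := by
      simp only [L, Finsupp.sum]
      exact Finset.sum_coe_sort c.support (fun i => c i • M.e i t)
    rw [← h2]
    refine closure_mono ?_ h1
    rintro _ ⟨k, rfl⟩
    exact ⟨(c.support, k), rfl⟩
  exact closure_minimal key isClosed_closure (h x)

theorem approx_inner_aemeasurable (M : MeasurableField ι K μ) {f : ∀ t, K t}
    (hf : f ∈ M.sections) (p : Finset ι × ℕ) :
    AEMeasurable (fun t => ⟪M.approx p t, f t⟫_ℂ) μ := by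
  simp only [approx, sum_inner, inner_smul_left]
  exact Finset.aemeasurable_fun_sum _ fun i _ => (hf i).const_mul _

theorem approx_mem_sections (M : MeasurableField ι K μ) (p : Finset ι × ℕ) :
    M.approx p ∈ M.sections := by
  intro n
  simp only [approx, inner_sum, inner_smul_right]
  exact Finset.aemeasurable_fun_sum _ fun i _ => (M.aemeasurable_inner n i).const_mul _

theorem enorm_eq_iSup {E ι' : Type*} [NormedAddCommGroup E] [InnerProductSpace ℂ E] {v : ι' → E}
    (hv : DenseRange v) (x : E) : ‖x‖ₑ = ⨆ i, ‖⟪v i, x⟫_ℂ‖ₑ / ‖v i‖ₑ := by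
  apply le_antisymm
  · by_cases hx : x = 0
    · simp [hx]
    have hx' : ‖x‖ ≠ 0 := by simpa using hx
    have hc : Tendsto (fun y : E => ‖⟪y, x⟫_ℂ‖ₑ / ‖y‖ₑ) (𝓝 x) (𝓝 (‖⟪x, x⟫_ℂ‖ₑ / ‖x‖ₑ)) := by
      apply ENNReal.Tendsto.div
      · exact (Continuous.enorm (by fun_prop)).tendsto x
      · right; simpa using hx'
      · exact continuous_enorm.tendsto x
      · left; simp
    have he : ‖⟪x, x⟫_ℂ‖ₑ / ‖x‖ₑ = ‖x‖ₑ := by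
      rw [inner_self_eq_norm_sq_to_K]
      rw [enorm_pow, sq]
      have : ‖((‖x‖ : ℝ) : ℂ)‖ₑ = ‖x‖ₑ := by
        rw [← ofReal_norm, ← ofReal_norm]; simp
      erw [this]
      rw [mul_div_assoc, ENNReal.div_self (by simpa using hx') (by simp), mul_one]
    rw [he] at hc
    have hcl : x ∈ closure (Set.range v) := hv x
    rw [mem_closure_iff_clusterPt] at hcl
    have hne : (𝓝 x ⊓ 𝓟 (Set.range v)).NeBot := hcl
    refine le_of_tendsto (x := 𝓝 x ⊓ 𝓟 (Set.range v)) (hc.mono_left inf_le_left) ?_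
    refine Filter.Eventually.filter_mono inf_le_right ?_
    rw [eventually_principal]
    rintro _ ⟨i, rfl⟩
    exact le_iSup (fun i => ‖⟪v i, x⟫_ℂ‖ₑ / ‖v i‖ₑ) i
  · refine iSup_le fun i => ?_
    refine ENNReal.div_le_of_le_mul ?_
    rw [mul_comm]
    rw [← ofReal_norm, ← ofReal_norm, ← ofReal_norm, ← ENNReal.ofReal_mul (norm_nonneg _)]
    exact ENNReal.ofReal_le_ofReal (norm_inner_le_norm _ _)

theorem aemeasurable_enorm_approx (M : MeasurableField ι K μ) (p : Finset ι × ℕ) :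
    AEMeasurable (fun t => ‖M.approx p t‖ₑ) μ := by
  have h := M.approx_inner_aemeasurable (M.approx_mem_sections p) p
  have h2 : (fun t => ‖M.approx p t‖ₑ) =
      fun t => ENNReal.ofReal (Real.sqrt ‖⟪M.approx p t, M.approx p t⟫_ℂ‖) := by
    funext t
    rw [inner_self_eq_norm_sq_to_K, ← ofReal_norm]
    simp
  rw [h2]
  fun_prop

variable [Countable ι]

theorem aemeasurable_enorm (M : MeasurableField ι K μ) {f : ∀ t, K t}
    (hf : f ∈ M.sections) : AEMeasurable (fun t => ‖f t‖ₑ) μ := by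
  have h1 : AEMeasurable (fun t => ⨆ p, ‖⟪M.approx p t, f t⟫_ℂ‖ₑ / ‖M.approx p t‖ₑ) μ := by
    refine AEMeasurable.iSup fun p => ?_
    exact (M.approx_inner_aemeasurable hf p).enorm.div (M.aemeasurable_enorm_approx p)
  refine h1.congr ?_
  filter_upwards [M.dense_span] with t ht
  exact (enorm_eq_iSup (M.dense_approx t ht) (f t)).symm

theorem aemeasurable_norm (M : MeasurableField ι K μ) {f : ∀ t, K t}
    (hf : f ∈ M.sections) : AEMeasurable (fun t => ‖f t‖) μ := by
  simpa using (M.aemeasurable_enorm hf).ennreal_toReal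

theorem aemeasurable_inner_sections (M : MeasurableField ι K μ) {f g : ∀ t, K t}
    (hf : f ∈ M.sections) (hg : g ∈ M.sections) : AEMeasurable (fun t => ⟪f t, g t⟫_ℂ) μ := by
  have h1 := M.aemeasurable_norm (M.sections.add_mem hf hg)
  have h2 := M.aemeasurable_norm (M.sections.sub_mem hf hg)
  have h3 := M.aemeasurable_norm (M.sections.sub_mem hf (M.sections.smul_mem Complex.I hg))
  have h4 := M.aemeasurable_norm (M.sections.add_mem hf (M.sections.smul_mem Complex.I hg))
  simp only [inner_eq_sum_norm_sq_div_four]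
  simp only [Pi.add_apply, Pi.sub_apply, Pi.smul_apply] at h1 h2 h3 h4
  have k : ∀ {a : ℝ → ℝ}, AEMeasurable a μ → AEMeasurable (fun t => ((a t : ℝ) : ℂ)) μ :=
    fun h => Complex.measurable_ofReal.comp_aemeasurable h
  exact ((((k h1).pow_const 2).sub ((k h2).pow_const 2)).add
    ((((k h3).pow_const 2).sub ((k h4).pow_const 2)).mul_const _)).div_const _

/-- Square integrable measurable sections, before identification of `μ`-a.e. equal ones. -/
def preL2 (M : MeasurableField ι K μ) : Submodule ℂ (∀ t, K t) where
  carrier := {f | f ∈ M.sections ∧ ∫⁻ t, ‖f t‖ₑ ^ 2 ∂μ < ⊤}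
  add_mem' := by
    rintro f g ⟨hf, hf'⟩ ⟨hg, hg'⟩
    refine ⟨M.sections.add_mem hf hg, ?_⟩
    have h2 : ∫⁻ t, (2 * ‖f t‖ₑ ^ 2 + 2 * ‖g t‖ₑ ^ 2) ∂μ < ⊤ := by
      rw [lintegral_add_left' (((M.aemeasurable_enorm hf).pow_const 2).const_mul 2),
        lintegral_const_mul' _ _ (by simp), lintegral_const_mul' _ _ (by simp)]
      exact ENNReal.add_lt_top.2 ⟨ENNReal.mul_lt_top (by simp) hf', ENNReal.mul_lt_top (by simp) hg'⟩
    refine lt_of_le_of_lt (lintegral_mono fun t => ?_) h2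
    calc ‖f t + g t‖ₑ ^ 2 ≤ (‖f t‖ₑ + ‖g t‖ₑ) ^ 2 := by gcongr; exact enorm_add_le _ _
      _ ≤ 2 * (‖f t‖ₑ ^ 2 + ‖g t‖ₑ ^ 2) := by
        have := ENNReal.rpow_add_le_mul_rpow_add_rpow ‖f t‖ₑ ‖g t‖ₑ (p := 2) (by norm_num)
        norm_num at this
        exact_mod_cast this
      _ = _ := by ring
  zero_mem' := ⟨M.sections.zero_mem, by simp⟩
  smul_mem' := by
    rintro c f ⟨hf, hf'⟩
    refine ⟨M.sections.smul_mem c hf, ?_⟩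
    simp only [Pi.smul_apply, enorm_smul, mul_pow]
    rw [lintegral_const_mul' _ _ (by simp)]
    exact ENNReal.mul_lt_top (by simp) hf'

theorem integrable_inner (M : MeasurableField ι K μ) {f g : ∀ t, K t}
    (hf : f ∈ M.preL2) (hg : g ∈ M.preL2) : Integrable (fun t => ⟪f t, g t⟫_ℂ) μ := by
  refine ⟨(M.aemeasurable_inner_sections hf.1 hg.1).aestronglyMeasurable, ?_⟩
  have h2 : ∫⁻ t, (‖f t‖ₑ ^ 2 + ‖g t‖ₑ ^ 2) ∂μ < ⊤ := by
    rw [lintegral_add_left' ((M.aemeasurable_enorm hf.1).pow_const 2)]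
    exact ENNReal.add_lt_top.2 ⟨hf.2, hg.2⟩
  refine lt_of_le_of_lt (lintegral_mono fun t => ?_) h2
  rw [← ofReal_norm, ← ofReal_norm, ← ofReal_norm, ← ENNReal.ofReal_pow (norm_nonneg _),
    ← ENNReal.ofReal_pow (norm_nonneg _), ← ENNReal.ofReal_add (by positivity) (by positivity)]
  refine ENNReal.ofReal_le_ofReal ?_
  have := norm_inner_le_norm (𝕜 := ℂ) (f t) (g t)
  nlinarith [sq_nonneg (‖f t‖ - ‖g t‖), sq_nonneg (‖f t‖ + ‖g t‖)]

theorem integral_inner_self (f : ∀ t, K t) :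
    ∫ t, ⟪f t, f t⟫_ℂ ∂μ = ((∫ t, ‖f t‖ ^ 2 ∂μ : ℝ) : ℂ) := by
  have h : (fun t => ⟪f t, f t⟫_ℂ) = fun t => ((‖f t‖ ^ 2 : ℝ) : ℂ) := by
    funext t
    simp [inner_self_eq_norm_sq_to_K]
  rw [h, integral_complex_ofReal]

theorem ofReal_integral_norm_sq (M : MeasurableField ι K μ) {f : ∀ t, K t} (hf : f ∈ M.preL2) :
    ENNReal.ofReal (∫ t, ‖f t‖ ^ 2 ∂μ) = ∫⁻ t, ‖f t‖ₑ ^ 2 ∂μ := by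
  rw [ofReal_integral_eq_lintegral_ofReal]
  · simp [ENNReal.ofReal_pow, ofReal_norm]
  · have := (M.integrable_inner hf hf).re
    simpa [inner_self_eq_norm_sq_to_K, ← Complex.ofReal_pow] using this
  · exact ae_of_all _ fun t => by positivity

/-- Membership in `preL2` only depends on the section up to `μ`-a.e. equality. -/
theorem preL2_congr (M : MeasurableField ι K μ) {f g : ∀ t, K t} (h : ∀ᵐ t ∂μ, f t = g t)
    (hf : f ∈ M.preL2) : g ∈ M.preL2 := by
  refine ⟨fun n => (hf.1 n).congr ?_, ?_⟩
  · filter_upwards [h] with t ht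
    rw [ht]
  · refine lt_of_eq_of_lt (lintegral_congr_ae ?_) hf.2
    filter_upwards [h] with t ht
    rw [ht]

/-- `preL2` as a type with its own (semi-)norm, rather than the product topology. -/
def PreL2 (M : MeasurableField ι K μ) : Type _ := M.preL2

namespace PreL2

variable (M : MeasurableField ι K μ)

instance : AddCommGroup M.PreL2 := inferInstanceAs (AddCommGroup M.preL2)

instance : Module ℂ M.PreL2 := inferInstanceAs (Module ℂ M.preL2)

variable {M} in
/-- The underlying section. -/
def fn (f : M.PreL2) : ∀ t, K t := Subtype.val (p := fun f => f ∈ M.preL2) f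

variable {M} in
theorem fn_mem (f : M.PreL2) : f.fn ∈ M.preL2 := Subtype.property (p := fun f => f ∈ M.preL2) f

variable {M} in
/-- The element of `PreL2` given by a square integrable section. -/
def of (f : ∀ t, K t) (hf : f ∈ M.preL2) : M.PreL2 := (⟨f, hf⟩ : M.preL2)

/-- The semi-inner product `(f, g) = ∫ (f(t), g(t)) dμ(t)`. -/
noncomputable instance core : PreInnerProductSpace.Core ℂ M.PreL2 where
  inner f g := ∫ t, ⟪f.fn t, g.fn t⟫_ℂ ∂μ
  conj_inner_symm f g := by
    rw [← integral_conj]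
    simp
  re_inner_nonneg f := by
    rw [integral_inner_self]
    exact integral_nonneg fun t => by positivity
  add_left f g h := by
    change ∫ t, ⟪f.fn t + g.fn t, h.fn t⟫_ℂ ∂μ = _
    simp only [inner_add_left]
    exact integral_add (M.integrable_inner f.fn_mem h.fn_mem) (M.integrable_inner g.fn_mem h.fn_mem)
  smul_left f g c := by
    change ∫ t, ⟪c • f.fn t, g.fn t⟫_ℂ ∂μ = _
    simp only [inner_smul_left]
    exact integral_const_mul _ _

noncomputable instance : SeminormedAddCommGroup M.PreL2 :=
  InnerProductSpace.Core.toSeminormedAddCommGroup (𝕜 := ℂ) (c := core M)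

noncomputable instance : InnerProductSpace ℂ M.PreL2 := InnerProductSpace.ofCore (core M)

variable {M}

theorem inner_def (f g : M.PreL2) : ⟪f, g⟫_ℂ = ∫ t, ⟪f.fn t, g.fn t⟫_ℂ ∂μ := rfl

theorem norm_sq (f : M.PreL2) : ‖f‖ ^ 2 = ∫ t, ‖f.fn t‖ ^ 2 ∂μ := by
  have := inner_self_eq_norm_sq_to_K (𝕜 := ℂ) f
  rw [inner_def, integral_inner_self] at this
  exact (Complex.ofReal_injective (by simpa using this)).symm

theorem enorm_sq (f : M.PreL2) : ‖f‖ₑ ^ 2 = ∫⁻ t, ‖f.fn t‖ₑ ^ 2 ∂μ := by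
  rw [← M.ofReal_integral_norm_sq f.fn_mem, ← norm_sq, ENNReal.ofReal_pow (norm_nonneg _),
    ofReal_norm]

theorem norm_eq_zero_iff (f : M.PreL2) : ‖f‖ = 0 ↔ ∀ᵐ t ∂μ, f.fn t = 0 := by
  have h1 : ‖f‖ = 0 ↔ ‖f‖ₑ ^ 2 = 0 := by
    rw [← ofReal_norm, sq_eq_zero_iff, ENNReal.ofReal_eq_zero]
    exact ⟨le_of_eq, fun h => le_antisymm h (norm_nonneg _)⟩
  rw [h1, enorm_sq, lintegral_eq_zero_iff' ((M.aemeasurable_enorm f.fn_mem.1).pow_const 2)]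
  refine eventually_congr (ae_of_all _ fun t => ?_)
  simp

theorem exists_lim_of_tsum {E : Type*} [NormedAddCommGroup E] [CompleteSpace E] {v : ℕ → E}
    (h : ∑' n, (4 : ℝ≥0∞) ^ n * ‖v (n + 1) - v n‖ₑ ^ 2 < ⊤) :
    ∃ x, Tendsto v atTop (𝓝 x) := by
  set C := ∑' n, (4 : ℝ≥0∞) ^ n * ‖v (n + 1) - v n‖ₑ ^ 2 with hC
  refine cauchySeq_tendsto_of_complete
    (cauchySeq_of_edist_le_geometric 2⁻¹ (C + 1) (by simp) (by simpa using h.ne) fun n => ?_)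
  have h1 : (2 ^ n * ‖v (n + 1) - v n‖ₑ) ^ 2 ≤ C := by
    refine le_trans (le_of_eq ?_)
      (ENNReal.le_tsum (f := fun n => (4 : ℝ≥0∞) ^ n * ‖v (n + 1) - v n‖ₑ ^ 2) n)
    rw [mul_pow, ← pow_mul, mul_comm n 2, pow_mul]
    norm_num
  have h2 : 2 ^ n * ‖v (n + 1) - v n‖ₑ ≤ C + 1 := by
    rcases le_total (2 ^ n * ‖v (n + 1) - v n‖ₑ) 1 with h | h
    · exact h.trans le_add_self
    · exact (le_self_pow₀ h (by norm_num)).trans (h1.trans le_self_add)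
  rw [edist_comm, edist_eq_enorm_sub]
  calc ‖v (n + 1) - v n‖ₑ = 2 ^ n * ‖v (n + 1) - v n‖ₑ * 2⁻¹ ^ n := by
        rw [mul_right_comm, ← mul_pow, ENNReal.mul_inv_cancel (by simp) (by simp)]
        simp
    _ ≤ _ := by gcongr

instance [∀ t, CompleteSpace (K t)] : CompleteSpace M.PreL2 := by
  classical
  refine EMetric.complete_of_convergent_controlled_sequences (fun n => 4⁻¹ ^ n)
    (fun n => by simp [ENNReal.pow_pos]) fun u hu => ?_
  have hu' : ∀ N n m, N ≤ n → N ≤ m →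
      ∫⁻ t, ‖(u n).fn t - (u m).fn t‖ₑ ^ 2 ∂μ ≤ (4⁻¹ ^ N) ^ 2 := by
    intro N n m hn hm
    have h1 := enorm_sq (u n - u m)
    change _ = ∫⁻ t, ‖(u n).fn t - (u m).fn t‖ₑ ^ 2 ∂μ at h1
    rw [← h1, ← edist_eq_enorm_sub]
    exact pow_le_pow_left' (hu N n m hn hm).le 2
  have hmeas : ∀ n m, AEMeasurable (fun t => ‖(u n).fn t - (u m).fn t‖ₑ ^ 2) μ := fun n m =>
    (M.aemeasurable_enorm (M.sections.sub_mem (u n).fn_mem.1 (u m).fn_mem.1)).pow_const 2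
  have hsum : ∀ᵐ t ∂μ, ∑' n, 4 ^ n * ‖(u (n + 1)).fn t - (u n).fn t‖ₑ ^ 2 < ⊤ := by
    refine ae_lt_top' (AEMeasurable.tsum fun n => (hmeas _ _).const_mul _) (ne_of_lt ?_)
    rw [lintegral_tsum fun n => (hmeas _ _).const_mul _]
    calc ∑' n, ∫⁻ t, 4 ^ n * ‖(u (n + 1)).fn t - (u n).fn t‖ₑ ^ 2 ∂μ
        ≤ ∑' n : ℕ, (4⁻¹ : ℝ≥0∞) ^ n := by
          refine ENNReal.tsum_le_tsum fun n => ?_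
          rw [lintegral_const_mul' _ _ (by simp)]
          calc (4 : ℝ≥0∞) ^ n * ∫⁻ t, ‖(u (n + 1)).fn t - (u n).fn t‖ₑ ^ 2 ∂μ
              ≤ 4 ^ n * (4⁻¹ ^ n) ^ 2 := by
                gcongr
                exact hu' n (n + 1) n (by omega) le_rfl
            _ = (4 * 4⁻¹) ^ n * 4⁻¹ ^ n := by rw [mul_pow]; ring
            _ = 4⁻¹ ^ n := by rw [ENNReal.mul_inv_cancel (by simp) (by simp)]; simp
      _ < ⊤ := by
          rw [ENNReal.tsum_geometric]
          simp only [ENNReal.inv_lt_top, tsub_pos_iff_lt]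
          simp [ENNReal.inv_lt_one]
  let f : ∀ t, K t := fun t => if h : ∃ x, Tendsto (fun n => (u n).fn t) atTop (𝓝 x) then
    h.choose else 0
  have hlim : ∀ᵐ t ∂μ, Tendsto (fun n => (u n).fn t) atTop (𝓝 (f t)) := by
    filter_upwards [hsum] with t ht
    have h : ∃ x, Tendsto (fun n => (u n).fn t) atTop (𝓝 x) := exists_lim_of_tsum ht
    simp only [f, dif_pos h]
    exact h.choose_spec
  have hfs : f ∈ M.sections := by
    intro k
    refine aemeasurable_of_tendsto_metrizable_ae atTop (fun n => (u n).fn_mem.1 k) ?_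
    filter_upwards [hlim] with t ht
    exact tendsto_const_nhds.inner ht
  have hfat : ∀ N, ∫⁻ t, ‖(u N).fn t - f t‖ₑ ^ 2 ∂μ ≤ (4⁻¹ ^ N) ^ 2 := by
    intro N
    calc ∫⁻ t, ‖(u N).fn t - f t‖ₑ ^ 2 ∂μ
        = ∫⁻ t, liminf (fun n => ‖(u N).fn t - (u n).fn t‖ₑ ^ 2) atTop ∂μ := by
          refine lintegral_congr_ae ?_
          filter_upwards [hlim] with t ht
          refine (Tendsto.liminf_eq ?_).symm
          exact ENNReal.Tendsto.pow ((continuous_enorm.tendsto _).comp (tendsto_const_nhds.sub ht))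
      _ ≤ liminf (fun n => ∫⁻ t, ‖(u N).fn t - (u n).fn t‖ₑ ^ 2 ∂μ) atTop :=
          lintegral_liminf_le' fun n => hmeas N n
      _ ≤ (4⁻¹ ^ N) ^ 2 := by
          refine liminf_le_of_frequently_le' (Eventually.frequently ?_)
          filter_upwards [eventually_ge_atTop N] with n hn
          exact hu' N N n le_rfl hn
  have hdiff : ∀ N, (fun t => (u N).fn t - f t) ∈ M.preL2 := fun N =>
    ⟨M.sections.sub_mem (u N).fn_mem.1 hfs, (hfat N).trans_lt (by simp)⟩
  have hf : f ∈ M.preL2 := by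
    have := M.preL2.sub_mem (u 0).fn_mem (hdiff 0)
    convert this using 1
    funext t
    simp
  refine ⟨of f hf, ?_⟩
  rw [tendsto_iff_edist_tendsto_0]
  have hpow : Tendsto (fun n : ℕ => (4⁻¹ : ℝ≥0∞) ^ n) atTop (𝓝 0) :=
    ENNReal.tendsto_pow_atTop_nhds_zero_of_lt_one (by simp [ENNReal.inv_lt_one])
  refine tendsto_of_tendsto_of_tendsto_of_le_of_le tendsto_const_nhds hpow (fun _ => bot_le)
    fun N => ?_
  have h1 := enorm_sq (u N - of f hf)
  change _ = ∫⁻ t, ‖(u N).fn t - f t‖ₑ ^ 2 ∂μ at h1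
  have h2 := hfat N
  rw [← h1, ← edist_eq_enorm_sub] at h2
  exact (ENNReal.pow_right_strictMono two_ne_zero).le_iff_le.1 h2

end PreL2

/-- The Hilbert space `L²(M; dμ)`: square integrable measurable sections modulo null sections. -/
def L2 (M : MeasurableField ι K μ) : Type _ := SeparationQuotient M.PreL2

namespace L2

variable (M : MeasurableField ι K μ)

noncomputable instance : NormedAddCommGroup M.L2 :=
  inferInstanceAs (NormedAddCommGroup (SeparationQuotient M.PreL2))

noncomputable instance : InnerProductSpace ℂ M.L2 :=
  inferInstanceAs (InnerProductSpace ℂ (SeparationQuotient M.PreL2))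

instance [∀ t, CompleteSpace (K t)] : CompleteSpace M.L2 :=
  inferInstanceAs (CompleteSpace (SeparationQuotient M.PreL2))

variable {M}

/-- The class of a square integrable section. -/
noncomputable def mk (f : ∀ t, K t) (hf : f ∈ M.preL2) : M.L2 :=
  SeparationQuotient.mk (PreL2.of f hf)

/-- A representative of a class. -/
noncomputable def fn (F : M.L2) : ∀ t, K t := PreL2.fn (Quotient.out F)

theorem fn_mem (F : M.L2) : F.fn ∈ M.preL2 := PreL2.fn_mem _

theorem mk_fn (F : M.L2) : mk F.fn F.fn_mem = F := Quotient.out_eq F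

theorem mk_eq_mk {f g : ∀ t, K t} (hf : f ∈ M.preL2) (hg : g ∈ M.preL2) :
    mk f hf = mk g hg ↔ ∀ᵐ t ∂μ, f t = g t := by
  refine SeparationQuotient.mk_eq_mk.trans ?_
  rw [Metric.inseparable_iff, dist_eq_norm, PreL2.norm_eq_zero_iff]
  refine eventually_congr (ae_of_all _ fun t => ?_)
  change f t - g t = 0 ↔ _
  exact sub_eq_zero

theorem mk_add {f g : ∀ t, K t} (hf : f ∈ M.preL2) (hg : g ∈ M.preL2) :
    mk (f + g) (M.preL2.add_mem hf hg) = mk f hf + mk g hg := rfl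

theorem mk_smul (c : ℂ) {f : ∀ t, K t} (hf : f ∈ M.preL2) :
    mk (c • f) (M.preL2.smul_mem c hf) = c • mk f hf := rfl

theorem fn_mk {f : ∀ t, K t} (hf : f ∈ M.preL2) : ∀ᵐ t ∂μ, (mk f hf).fn t = f t :=
  (mk_eq_mk (fn_mem _) hf).1 (mk_fn _)

theorem ext_ae {F G : M.L2} (h : ∀ᵐ t ∂μ, F.fn t = G.fn t) : F = G := by
  rw [← mk_fn F, ← mk_fn G]
  exact (mk_eq_mk _ _).2 h

theorem fn_add (F G : M.L2) : ∀ᵐ t ∂μ, (F + G).fn t = F.fn t + G.fn t := by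
  have h := fn_mk (M.preL2.add_mem F.fn_mem G.fn_mem)
  rwa [mk_add F.fn_mem G.fn_mem, mk_fn, mk_fn] at h

theorem fn_smul (c : ℂ) (F : M.L2) : ∀ᵐ t ∂μ, (c • F).fn t = c • F.fn t := by
  have h := fn_mk (M.preL2.smul_mem c F.fn_mem)
  rwa [mk_smul c F.fn_mem, mk_fn] at h

theorem fn_zero : ∀ᵐ t ∂μ, (0 : M.L2).fn t = 0 := by
  simpa using fn_smul (0 : ℂ) (0 : M.L2)

theorem inner_def (F G : M.L2) : ⟪F, G⟫_ℂ = ∫ t, ⟪F.fn t, G.fn t⟫_ℂ ∂μ := by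
  conv_lhs => rw [← mk_fn F, ← mk_fn G]
  rfl

end L2

/-- The domain `L²(M; (1 + t²) dμ)` of the operator of multiplication by `t` in `L²(M; dμ)`. -/
def mulDomain (M : MeasurableField ι K μ) : Submodule ℂ M.L2 where
  carrier := {F | F.fn ∈ (M.mono
    (withDensity_absolutelyContinuous μ fun t => ENNReal.ofReal (1 + t ^ 2))).preL2}
  add_mem' := by
    intro F G hF hG
    refine preL2_congr _ ?_ (Submodule.add_mem _ hF hG)
    refine (withDensity_absolutelyContinuous μ _).ae_le ?_
    filter_upwards [L2.fn_add F G] with t ht using ht.symm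
  zero_mem' := by
    refine preL2_congr _ ?_ (Submodule.zero_mem _)
    refine (withDensity_absolutelyContinuous μ _).ae_le ?_
    filter_upwards [L2.fn_zero (M := M)] with t ht using ht.symm
  smul_mem' := by
    intro c F hF
    refine preL2_congr _ ?_ (Submodule.smul_mem _ c hF)
    refine (withDensity_absolutelyContinuous μ _).ae_le ?_
    filter_upwards [L2.fn_smul c F] with t ht using ht.symm

theorem mul_mem_preL2 (M : MeasurableField ι K μ) {F : M.L2} (hF : F ∈ M.mulDomain) :
    (fun t : ℝ => (t : ℂ) • F.fn t) ∈ M.preL2 := by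
  refine ⟨fun n => ?_, lt_of_le_of_lt ?_ hF.2⟩
  · simp only [inner_smul_right]
    exact Complex.measurable_ofReal.aemeasurable.mul (F.fn_mem.1 n)
  · rw [lintegral_withDensity_eq_lintegral_mul₀ (by fun_prop)
      ((M.aemeasurable_enorm F.fn_mem.1).pow_const 2)]
    refine lintegral_mono fun t => ?_
    simp only [Pi.mul_apply, enorm_smul, mul_pow]
    gcongr
    rw [← ofReal_norm, ← ENNReal.ofReal_pow (norm_nonneg _)]
    refine ENNReal.ofReal_le_ofReal ?_
    simp

/-- The operator of multiplication by the independent variable in `L²(M; dμ)`. -/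
noncomputable def mulOp (M : MeasurableField ι K μ) : M.L2 →ₗ.[ℂ] M.L2 where
  domain := M.mulDomain
  toFun :=
    { toFun := fun F => L2.mk (fun t : ℝ => (t : ℂ) • (F : M.L2).fn t) (M.mul_mem_preL2 F.2)
      map_add' := by
        intro F G
        rw [← L2.mk_add, L2.mk_eq_mk]
        filter_upwards [L2.fn_add (F : M.L2) G] with t ht
        simp [ht]
      map_smul' := by
        intro c F
        rw [RingHom.id_apply, ← L2.mk_smul, L2.mk_eq_mk]
        filter_upwards [L2.fn_smul c (F : M.L2)] with t ht
        simp [ht, smul_comm (t : ℂ) c] }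

end MeasurableField

/-- The space of finite formal combinations `∑ αₙ eₙ`, with the semi-inner product
`(∑ αₘ eₘ, ∑ βₙ eₙ) = ∑ conj αₘ Gₘₙ βₙ` given by a positive semidefinite matrix `G`. -/
def GramPre {ι : Type*} (_G : {G : Matrix ι ι ℂ // G.PosSemidef}) : Type _ := ι →₀ ℂ

namespace GramPre

variable {ι : Type*} (G : {G : Matrix ι ι ℂ // G.PosSemidef})

noncomputable instance : AddCommGroup (GramPre G) := inferInstanceAs (AddCommGroup (ι →₀ ℂ))

noncomputable instance : Module ℂ (GramPre G) := inferInstanceAs (Module ℂ (ι →₀ ℂ))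

/-- The combination with the given coefficients. -/
def of (a : ι →₀ ℂ) : GramPre G := a

/-- The coefficients. -/
def coeff (v : GramPre G) : ι →₀ ℂ := v

noncomputable instance core : PreInnerProductSpace.Core ℂ (GramPre G) where
  inner v w := (coeff G v).sum fun m a => (coeff G w).sum fun n b => star a * G.1 m n * b
  conj_inner_symm v w := by
    rw [Finsupp.sum_comm]
    simp only [map_finsuppSum]
    refine Finsupp.sum_congr fun m _ => Finsupp.sum_congr fun n _ => ?_
    rw [← G.2.isHermitian.apply m n]
    simp [mul_comm, mul_left_comm]
  re_inner_nonneg v := (RCLike.nonneg_iff.1 (G.2.2 (coeff G v))).1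
  add_left u v w := by
    change Finsupp.sum (coeff G u + coeff G v) _ = _
    rw [Finsupp.sum_add_index'] <;> simp [← Finsupp.sum_add, add_mul]
  smul_left v w c := by
    change Finsupp.sum (c • coeff G v) _ = _
    rw [Finsupp.sum_smul_index] <;> simp [Finsupp.mul_sum, ← mul_assoc]

noncomputable instance : SeminormedAddCommGroup (GramPre G) :=
  InnerProductSpace.Core.toSeminormedAddCommGroup (𝕜 := ℂ) (c := core G)

noncomputable instance : InnerProductSpace ℂ (GramPre G) := InnerProductSpace.ofCore (core G)

theorem inner_of (a b : ι →₀ ℂ) :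
    ⟪of G a, of G b⟫_ℂ = a.sum fun m x => b.sum fun n y => star x * G.1 m n * y := rfl

end GramPre

/-- The Hilbert space obtained from `GramPre G` by dividing out null vectors and completing. -/
abbrev GramSpace {ι : Type*} (G : {G : Matrix ι ι ℂ // G.PosSemidef}) : Type _ :=
  UniformSpace.Completion (GramPre G)

namespace GramSpace

variable {ι : Type*} (G : {G : Matrix ι ι ℂ // G.PosSemidef})

/-- The image of the basis vector `eₙ`. -/
noncomputable def basisVec (n : ι) : GramSpace G :=
  ((GramPre.of G (Finsupp.single n 1) : GramPre G) : UniformSpace.Completion (GramPre G))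

theorem inner_basisVec (m n : ι) : ⟪basisVec G m, basisVec G n⟫_ℂ = G.1 m n := by
  rw [basisVec, basisVec, UniformSpace.Completion.inner_coe, GramPre.inner_of]
  simp

theorem dense_span_basisVec :
    Dense (Submodule.span ℂ (Set.range (basisVec G)) : Set (GramSpace G)) := by
  refine (UniformSpace.Completion.denseRange_coe (α := GramPre G)).mono ?_
  rintro _ ⟨v, rfl⟩
  change (UniformSpace.Completion.toComplₗᵢ (𝕜 := ℂ) (E := GramPre G)) v ∈ _
  have hv : v = ∑ n ∈ (GramPre.coeff G v).support,
      (GramPre.coeff G v) n • GramPre.of G (Finsupp.single n 1) := by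
    conv_lhs => rw [show v = (GramPre.coeff G v : ι →₀ ℂ) from rfl,
      ← Finsupp.sum_single (GramPre.coeff G v)]
    refine Finset.sum_congr rfl fun n _ => ?_
    change Finsupp.single n _ = ((GramPre.coeff G v) n • Finsupp.single n (1 : ℂ) : ι →₀ ℂ)
    rw [Finsupp.smul_single, smul_eq_mul, mul_one]
  rw [hv, map_sum]
  refine Submodule.sum_mem _ fun n _ => ?_
  rw [map_smul]
  exact Submodule.smul_mem _ _ (Submodule.subset_span ⟨n, rfl⟩)

end GramSpace

/-- A positive bounded-operator-valued measure on the Borel sets of `ℝ`, countably additive in the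
strong operator topology. (The values on non-Borel sets are irrelevant.) -/
structure PositiveOperatorMeasure (N : Type*) [NormedAddCommGroup N] [InnerProductSpace ℂ N] where
  toFun : Set ℝ → N →L[ℂ] N
  isPositive : ∀ B, MeasurableSet B → (toFun B).IsPositive
  hasSum_iUnion : ∀ B : ℕ → Set ℝ, (∀ n, MeasurableSet (B n)) →
    Pairwise (Function.onFun Disjoint B) → ∀ ξ, HasSum (fun n => toFun (B n) ξ) (toFun (⋃ n, B n) ξ)

namespace PositiveOperatorMeasure

variable {N : Type*} [NormedAddCommGroup N] [InnerProductSpace ℂ N]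

theorem apply_empty (Ω : PositiveOperatorMeasure N) : Ω.toFun ∅ = 0 := by
  ext ξ
  have h := Ω.hasSum_iUnion (fun _ => ∅) (fun _ => MeasurableSet.empty)
    (fun _ _ _ => by simp [Function.onFun]) ξ
  simpa using tendsto_nhds_unique h.summable.tendsto_atTop_zero tendsto_const_nhds |>.symm

theorem hasSum_inner (Ω : PositiveOperatorMeasure N) (ξ η : N) (B : ℕ → Set ℝ)
    (h : ∀ n, MeasurableSet (B n)) (h' : Pairwise (Function.onFun Disjoint B)) :
    HasSum (fun n => ⟪ξ, Ω.toFun (B n) η⟫_ℂ) ⟪ξ, Ω.toFun (⋃ n, B n) η⟫_ℂ :=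
  (Ω.hasSum_iUnion B h h' η).mapL (innerSL ℂ ξ)

/-- The measure `B ↦ (ξ, Ω(B) ξ)`, i.e. `d(ξ, Ω ξ)`. -/
noncomputable def scalarMeasure (Ω : PositiveOperatorMeasure N) (ξ : N) : Measure ℝ :=
  Measure.ofMeasurable (fun B _ => ENNReal.ofReal (RCLike.re ⟪ξ, Ω.toFun B ξ⟫_ℂ))
    (by simp [apply_empty])
    (by
      intro B h h'
      have hs := (Ω.hasSum_inner ξ ξ B h h').mapL (RCLike.reCLM (K := ℂ))
      refine Eq.trans ?_ (ENNReal.ofReal_tsum_of_nonneg (fun n => ?_) hs.summable)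
      · exact congrArg _ hs.tsum_eq.symm
      · exact (Ω.isPositive _ (h n)).re_inner_nonneg_right ξ)

theorem scalarMeasure_apply (Ω : PositiveOperatorMeasure N) (ξ : N) {B : Set ℝ}
    (hB : MeasurableSet B) :
    Ω.scalarMeasure ξ B = ENNReal.ofReal (RCLike.re ⟪ξ, Ω.toFun B ξ⟫_ℂ) :=
  Measure.ofMeasurable_apply B hB

open scoped Classical in
/-- The complex measure `B ↦ (ξ, Ω(B) η)`. -/
noncomputable def complexMeasure (Ω : PositiveOperatorMeasure N) (ξ η : N) : ComplexMeasure ℝ where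
  measureOf' B := if MeasurableSet B then ⟪ξ, Ω.toFun B η⟫_ℂ else 0
  empty' := by simp [apply_empty]
  not_measurable' B hB := by simp [hB]
  m_iUnion' B h h' := by
    simpa [h, MeasurableSet.iUnion h] using Ω.hasSum_inner ξ η B h h'

theorem complexMeasure_apply (Ω : PositiveOperatorMeasure N) (ξ η : N) {B : Set ℝ}
    (hB : MeasurableSet B) : Ω.complexMeasure ξ η B = ⟪ξ, Ω.toFun B η⟫_ℂ :=
  if_pos hB

theorem eq_zero_of_inner_eq_zero {A : N →L[ℂ] N} (hA : A.IsPositive) {ξ : N}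
    (h : RCLike.re ⟪ξ, A ξ⟫_ℂ = 0) : A ξ = 0 := by
  let c : PreInnerProductSpace.Core ℂ N :=
    { inner := fun x y => ⟪x, A y⟫_ℂ
      conj_inner_symm := fun x y => by
        rw [inner_conj_symm]
        exact hA.inner_left_eq_inner_right x y
      re_inner_nonneg := fun x => hA.re_inner_nonneg_right x
      add_left := fun x y z => inner_add_left _ _ _
      smul_left := fun x y r => inner_smul_left _ _ _ }
  have h1 : ‖⟪A ξ, A ξ⟫_ℂ‖ * ‖⟪ξ, A (A ξ)⟫_ℂ‖ ≤
      RCLike.re ⟪A ξ, A (A ξ)⟫_ℂ * RCLike.re ⟪ξ, A ξ⟫_ℂ :=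
    InnerProductSpace.Core.inner_mul_inner_self_le (c := c) (A ξ) ξ
  rw [h, mul_zero, ← hA.inner_left_eq_inner_right ξ (A ξ)] at h1
  have h2 : ‖⟪A ξ, A ξ⟫_ℂ‖ = 0 := by nlinarith [norm_nonneg ⟪A ξ, A ξ⟫_ℂ]
  simpa using h2

variable {I : Set ℕ} (u : HilbertBasis I ℂ N) (Ω : PositiveOperatorMeasure N)

/-- The control measure `μ(B) = ∑ₙ 2⁻ⁿ (uₙ, Ω(B) uₙ)`. -/
noncomputable def control : Measure ℝ :=
  Measure.sum fun n : I => (2⁻¹ : ℝ≥0∞) ^ (n : ℕ) • Ω.scalarMeasure (u n)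

instance : IsFiniteMeasure (Ω.control u) := by
  refine ⟨?_⟩
  rw [control, Measure.sum_apply _ MeasurableSet.univ]
  calc ∑' n : I, ((2⁻¹ : ℝ≥0∞) ^ (n : ℕ) • Ω.scalarMeasure (u n)) Set.univ
      ≤ ∑' n : I, (2⁻¹ : ℝ≥0∞) ^ (n : ℕ) * ENNReal.ofReal ‖Ω.toFun Set.univ‖ := by
        refine ENNReal.tsum_le_tsum fun n => ?_
        rw [Measure.smul_apply, smul_eq_mul, scalarMeasure_apply _ _ MeasurableSet.univ]
        gcongr
        refine (RCLike.re_le_norm _).trans ((norm_inner_le_norm _ _).trans ?_)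
        have h1 : ‖u n‖ = 1 := u.orthonormal.1 n
        have h2 := (Ω.toFun Set.univ).le_opNorm (u n)
        rw [h1] at h2 ⊢
        linarith
    _ = (∑' n : I, (2⁻¹ : ℝ≥0∞) ^ (n : ℕ)) * ENNReal.ofReal ‖Ω.toFun Set.univ‖ :=
        ENNReal.tsum_mul_right
    _ < ⊤ := by
        refine ENNReal.mul_lt_top (lt_of_le_of_lt
          (ENNReal.tsum_comp_le_tsum_of_injective Subtype.val_injective
            fun n : ℕ => (2⁻¹ : ℝ≥0∞) ^ n) ?_) ENNReal.ofReal_lt_top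
        rw [ENNReal.tsum_geometric]
        simp

theorem complexMeasure_eq_zero (m n : I) {B : Set ℝ} (hB : MeasurableSet B)
    (h : Ω.control u B = 0) : ⟪u m, Ω.toFun B (u n)⟫_ℂ = 0 := by
  rw [control, Measure.sum_apply _ hB, ENNReal.tsum_eq_zero] at h
  have h1 := h n
  rw [Measure.smul_apply, smul_eq_mul, scalarMeasure_apply _ _ hB, mul_eq_zero] at h1
  have h2 := h1.resolve_left (by simp)
  rw [ENNReal.ofReal_eq_zero] at h2
  rw [eq_zero_of_inner_eq_zero (Ω.isPositive B hB)
    (le_antisymm h2 ((Ω.isPositive B hB).re_inner_nonneg_right _)), inner_zero_right]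

/-- The Radon-Nikodym derivatives `φₘₙ = d(uₘ, Ω uₙ) / dμ`. -/
noncomputable def density (m n : I) : ℝ → ℂ :=
  (Ω.complexMeasure (u m) (u n)).rnDeriv (Ω.control u)

theorem integrable_density (m n : I) : Integrable (Ω.density u m n) (Ω.control u) :=
  ComplexMeasure.integrable_rnDeriv _ _

theorem setIntegral_density (m n : I) {B : Set ℝ} (hB : MeasurableSet B) :
    ∫ t in B, Ω.density u m n t ∂(Ω.control u) = ⟪u m, Ω.toFun B (u n)⟫_ℂ := by
  set c := Ω.complexMeasure (u m) (u n) with hc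
  have hre : c.re ≪ᵥ (Ω.control u).toENNRealVectorMeasure := by
    refine VectorMeasure.AbsolutelyContinuous.mk fun s hs h => ?_
    rw [Measure.toENNRealVectorMeasure_apply_measurable hs] at h
    change (c s).re = 0
    rw [hc, complexMeasure_apply _ _ _ hs, complexMeasure_eq_zero u Ω m n hs h, Complex.zero_re]
  have him : c.im ≪ᵥ (Ω.control u).toENNRealVectorMeasure := by
    refine VectorMeasure.AbsolutelyContinuous.mk fun s hs h => ?_
    rw [Measure.toENNRealVectorMeasure_apply_measurable hs] at h
    change (c s).im = 0
    rw [hc, complexMeasure_apply _ _ _ hs, complexMeasure_eq_zero u Ω m n hs h, Complex.zero_im]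
  have hre' := congrArg (fun v => v B) (SignedMeasure.withDensityᵥ_rnDeriv_eq _ _ hre)
  have him' := congrArg (fun v => v B) (SignedMeasure.withDensityᵥ_rnDeriv_eq _ _ him)
  beta_reduce at hre' him'
  rw [withDensityᵥ_apply (SignedMeasure.integrable_rnDeriv _ _) hB] at hre' him'
  rw [← complexMeasure_apply _ _ _ hB, ← hc]
  have hint := (Ω.integrable_density u m n).integrableOn (s := B)
  apply Complex.ext
  · refine Eq.trans ?_ hre'
    exact (integral_re hint).symm
  · refine Eq.trans ?_ him'
    exact (integral_im hint).symm

/-- The matrix `(φₘₙ(t))`. -/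
noncomputable def densityMatrix (t : ℝ) : Matrix I I ℂ := Matrix.of fun m n => Ω.density u m n t

theorem ae_posSemidef : ∀ᵐ t ∂(Ω.control u), (Ω.densityMatrix u t).PosSemidef := by
  have hherm : ∀ᵐ t ∂(Ω.control u), ∀ m n : I, star (Ω.density u m n t) = Ω.density u n m t := by
    rw [ae_all_iff]; intro m
    rw [ae_all_iff]; intro n
    have hi : Integrable (fun t => conj (Ω.density u m n t)) (Ω.control u) :=
      (RCLike.conjCLE (K := ℂ)).toContinuousLinearMap.integrable_comp (Ω.integrable_density u m n)
    refine Integrable.ae_eq_of_forall_setIntegral_eq _ _ hi (Ω.integrable_density u n m) ?_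
    intro s hs _
    refine integral_conj.trans ?_
    rw [setIntegral_density u Ω m n hs, setIntegral_density u Ω n m hs, inner_conj_symm]
    exact (Ω.isPositive s hs).inner_left_eq_inner_right _ _
  let Q : (s : Finset I) → (s → ℂ) → ℝ → ℂ := fun s a t =>
    ∑ m : s, ∑ n : s, star (a m) * Ω.density u m n t * a n
  have hQi : ∀ s a, Integrable (Q s a) (Ω.control u) := fun s a =>
    integrable_finsetSum _ fun m _ => integrable_finsetSum _ fun n _ =>
      ((Ω.integrable_density u m n).const_mul _).mul_const _
  have hQ : ∀ s a B, MeasurableSet B → ∫ t in B, Q s a t ∂(Ω.control u) =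
      ⟪∑ m : s, a m • u m, Ω.toFun B (∑ m : s, a m • u m)⟫_ℂ := by
    intro s a B hB
    have hI : ∀ m n : s, Integrable (fun t => star (a m) * Ω.density u m n t * a n)
        ((Ω.control u).restrict B) := fun m n =>
      (((Ω.integrable_density u m n).integrableOn).const_mul _).mul_const _
    refine (integral_finsetSum _ fun m _ => integrable_finsetSum _ fun n _ => hI m n).trans ?_
    rw [map_sum, sum_inner]
    refine Finset.sum_congr rfl fun m _ => ?_
    refine (integral_finsetSum _ fun n _ => hI m n).trans ?_
    rw [inner_sum]
    refine Finset.sum_congr rfl fun n _ => ?_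
    rw [integral_mul_const, integral_const_mul, setIntegral_density u Ω m n hB, map_smul,
      inner_smul_left, inner_smul_right]
    simp only [RCLike.star_def]
    ring
  have hQ0 : ∀ᵐ t ∂(Ω.control u), ∀ s k,
      0 ≤ Q s (TopologicalSpace.denseSeq (s → ℂ) k) t := by
    rw [ae_all_iff]; intro s
    rw [ae_all_iff]; intro k
    set a := TopologicalSpace.denseSeq (s → ℂ) k
    have hnn : ∀ B, MeasurableSet B → 0 ≤ ∫ t in B, Q s a t ∂(Ω.control u) := fun B hB => by
      rw [hQ s a B hB]
      exact (Ω.isPositive B hB).inner_nonneg_right _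
    have h1 : 0 ≤ᵐ[Ω.control u] fun t => (Q s a t).re := by
      refine ae_nonneg_of_forall_setIntegral_nonneg (hQi s a).re fun B hB _ => ?_
      exact (Complex.le_def.1 (hnn B hB)).1.trans_eq (integral_re (hQi s a).integrableOn).symm
    have h2 : (fun t => (Q s a t).im) =ᵐ[Ω.control u] 0 := by
      refine (hQi s a).im.ae_eq_zero_of_forall_setIntegral_eq_zero fun B hB _ => ?_
      exact (integral_im (hQi s a).integrableOn).trans (Complex.le_def.1 (hnn B hB)).2.symm
    filter_upwards [h1, h2] with t h1 h2
    exact Complex.le_def.2 ⟨h1, h2.symm⟩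
  filter_upwards [hherm, hQ0] with t hh hq
  refine ⟨?_, fun x => ?_⟩
  · ext m n
    exact hh n m
  · have hc : Continuous fun a : x.support → ℂ => Q x.support a t := by
      simp only [Q]
      fun_prop
    have hcl : IsClosed {a : x.support → ℂ | 0 ≤ Q x.support a t} :=
      isClosed_le continuous_const hc
    have hall : ∀ a : x.support → ℂ, 0 ≤ Q x.support a t := by
      intro a
      have h1 : closure (Set.range (TopologicalSpace.denseSeq (x.support → ℂ))) ⊆
          {a : x.support → ℂ | 0 ≤ Q x.support a t} := by
        refine closure_minimal ?_ hcl
        rintro _ ⟨k, rfl⟩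
        exact hq _ k
      exact h1 (TopologicalSpace.denseRange_denseSeq _ a)
    have := hall fun m => x m
    refine this.trans_eq ?_
    simp only [Q, Finsupp.sum, densityMatrix, Matrix.of_apply]
    rw [← Finset.sum_coe_sort x.support]
    refine Finset.sum_congr rfl fun m _ => ?_
    rw [← Finset.sum_coe_sort x.support]

open scoped Classical in
/-- The matrix `(φₘₙ(t))`, with the null set where it fails to be positive semidefinite removed. -/
noncomputable def gram (t : ℝ) : {G : Matrix I I ℂ // G.PosSemidef} :=
  if h : (Ω.densityMatrix u t).PosSemidef then ⟨_, h⟩ else ⟨0, Matrix.PosSemidef.zero⟩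

theorem ae_gram_eq : ∀ᵐ t ∂(Ω.control u), ∀ m n, (Ω.gram u t).1 m n = Ω.density u m n t := by
  filter_upwards [Ω.ae_posSemidef u] with t ht m n
  rw [gram, dif_pos ht]
  rfl

/-- The fibre Hilbert space at `t`: the completion of `lin.span {uₙ}` with respect to the
semi-inner product with Gram matrix `(φₘₙ(t))`. -/
abbrev Fiber (t : ℝ) : Type := GramSpace (Ω.gram u t)

/-- The measurable family of fibre spaces, generated by the constant sections `t ↦ uₙ`. -/
noncomputable def field : MeasurableField I (Ω.Fiber u) (Ω.control u) where
  e n t := GramSpace.basisVec (Ω.gram u t) n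
  aemeasurable_inner m n := by
    simp only [GramSpace.inner_basisVec]
    refine (Ω.integrable_density u m n).aestronglyMeasurable.aemeasurable.congr ?_
    filter_upwards [Ω.ae_gram_eq u] with t ht using (ht m n).symm
  dense_span := ae_of_all _ fun t => GramSpace.dense_span_basisVec _

theorem integral_inner_e (m n : I) :
    ∫ t, ⟪(Ω.field u).e m t, (Ω.field u).e n t⟫_ℂ ∂(Ω.control u) =
      ⟪u m, Ω.toFun Set.univ (u n)⟫_ℂ := by
  rw [← setIntegral_density u Ω m n MeasurableSet.univ, setIntegral_univ]
  refine integral_congr_ae ?_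
  filter_upwards [Ω.ae_gram_eq u] with t ht
  exact (GramSpace.inner_basisVec _ m n).trans (ht m n)

theorem e_mem_preL2 (n : I) : (Ω.field u).e n ∈ (Ω.field u).preL2 := by
  refine ⟨fun m => (Ω.field u).aemeasurable_inner m n, ?_⟩
  refine lt_of_eq_of_lt (lintegral_congr_ae ?_) (Ω.integrable_density u n n).2
  filter_upwards [Ω.ae_gram_eq u] with t ht
  rw [← ht n n, ← GramSpace.inner_basisVec, ← ofReal_norm, ← ofReal_norm,
    ← ENNReal.ofReal_pow (norm_nonneg _), inner_self_eq_norm_sq_to_K]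
  simp [field]

/-- The map `v = ∑ αₙ uₙ ↦ {v(t) = v}` from finite combinations to `L²(ℝ, N; dΩ)`,
which is `L²` of the measurable family `field` with respect to the control measure. -/
noncomputable def constSection : (I →₀ ℂ) →ₗ[ℂ] (Ω.field u).L2 :=
  Finsupp.linearCombination ℂ fun n => MeasurableField.L2.mk _ (Ω.e_mem_preL2 u n)

/-- The bounded map `Λ : N → L²(ℝ, N; dΩ)`, the continuous extension of `v ↦ {v(t) = v}` from
`lin.span {uₙ}` to `N`. -/
noncomputable def Lam : N →L[ℂ] (Ω.field u).L2 :=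
  (Ω.constSection u).extendOfNorm (Finsupp.linearCombination ℂ fun n => u n)

theorem norm_constSection_sq (a : I →₀ ℂ) : ‖Ω.constSection u a‖ ^ 2 =
    RCLike.re ⟪Finsupp.linearCombination ℂ (fun n => u n) a,
      Ω.toFun Set.univ (Finsupp.linearCombination ℂ (fun n => u n) a)⟫_ℂ := by
  rw [← inner_self_eq_norm_sq (𝕜 := ℂ)]
  congr 1
  simp only [constSection, Finsupp.linearCombination_apply, Finsupp.sum, map_sum, sum_inner,
    inner_sum, map_smul, inner_smul_left, inner_smul_right]
  refine Finset.sum_congr rfl fun n _ => ?_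
  congr 1
  refine Finset.sum_congr rfl fun m _ => ?_
  congr 1
  rw [← Ω.integral_inner_e u m n, MeasurableField.L2.inner_def]
  refine integral_congr_ae ?_
  filter_upwards [MeasurableField.L2.fn_mk (Ω.e_mem_preL2 u n),
    MeasurableField.L2.fn_mk (Ω.e_mem_preL2 u m)] with t h1 h2
  rw [h1, h2]

theorem denseRange_linearCombination :
    DenseRange (Finsupp.linearCombination ℂ fun n => u n) := by
  have h := u.dense_span
  have h2 : (Set.range (Finsupp.linearCombination ℂ fun n => u n)) =
      (Submodule.span ℂ (Set.range u) : Set N) := by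
    rw [← Finsupp.range_linearCombination]; rfl
  rw [DenseRange, h2, Submodule.dense_iff_topologicalClosure_eq_top]
  exact h

theorem Lam_basis (n : I) : Ω.Lam u (u n) = MeasurableField.L2.mk _ (Ω.e_mem_preL2 u n) := by
  have h := LinearMap.extendOfNorm_eq (f := Ω.constSection u)
    (e := Finsupp.linearCombination ℂ fun n => u n) (denseRange_linearCombination u)
    ⟨Real.sqrt ‖Ω.toFun Set.univ‖, fun a => ?_⟩ (Finsupp.single n 1)
  · simpa [Lam, constSection] using h
  · refine abs_le_of_sq_le_sq' ?_ (by positivity) |>.2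
    rw [norm_constSection_sq, mul_pow, Real.sq_sqrt (norm_nonneg _)]
    refine (RCLike.re_le_norm _).trans ((norm_inner_le_norm _ _).trans ?_)
    have h2 := (Ω.toFun Set.univ).le_opNorm (Finsupp.linearCombination ℂ (fun n => u n) a)
    nlinarith [norm_nonneg (Finsupp.linearCombination ℂ (fun n => u n) a)]

/-- The weight `1 + t²` as an extended nonnegative number. -/
noncomputable def weight (t : ℝ) : ℝ≥0∞ := ENNReal.ofReal (1 + t ^ 2)

/-- The measurable family of fibre spaces, over the measure `(1 + t²) dμ(t)`. -/
noncomputable def modelField :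
    MeasurableField I (Ω.Fiber u) ((Ω.control u).withDensity weight) :=
  (Ω.field u).mono (withDensity_absolutelyContinuous _ _)

/-- The model space `L²(ℝ, N; (1 + t²) dΩ)`. -/
abbrev ModelSpace : Type := (Ω.modelField u).L2

/-- The self-adjoint operator of multiplication by the independent variable in the model space. -/
noncomputable def modelOp : Ω.ModelSpace u →ₗ.[ℂ] Ω.ModelSpace u := (Ω.modelField u).mulOp

theorem control_absolutelyContinuous :
    Ω.control u ≪ (Ω.control u).withDensity weight := by
  have hw : Measurable weight := by unfold weight; fun_prop
  refine withDensity_absolutelyContinuous' hw.aemeasurable (ae_of_all _ fun t => ?_)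
  simp only [weight, ne_eq, ENNReal.ofReal_eq_zero, not_le]
  positivity

/-- On the domain of the multiplication operator, `(1 + t²) F` is in `L²(ℝ, N; dΩ)`. -/
theorem weight_smul_mem_preL2 {F : Ω.ModelSpace u} (hF : F ∈ (Ω.modelField u).mulDomain) :
    (fun t : ℝ => ((1 + t ^ 2 : ℝ) : ℂ) • F.fn t) ∈ (Ω.field u).preL2 := by
  have hw : Measurable weight := by unfold weight; fun_prop
  have hw' : Measurable fun t : ℝ => ENNReal.ofReal (1 + t ^ 2) := by fun_prop
  have hac := Ω.control_absolutelyContinuous u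
  refine ⟨fun n => ?_, lt_of_eq_of_lt ?_ hF.2⟩
  · simp only [inner_smul_right]
    refine AEMeasurable.mul (by fun_prop) ((F.fn_mem.1 n).mono_ac hac)
  · have hm : AEMeasurable (fun t => ‖F.fn t‖ₑ ^ 2) ((Ω.control u).withDensity weight) :=
      ((Ω.modelField u).aemeasurable_enorm F.fn_mem.1).pow_const 2
    rw [lintegral_withDensity_eq_lintegral_mul₀ hw'.aemeasurable hm,
      lintegral_withDensity_eq_lintegral_mul₀ hw.aemeasurable
        (hw'.aemeasurable.mul (hm.mono_ac hac))]
    refine lintegral_congr fun t => ?_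
    have h1 : ‖((1 + t ^ 2 : ℝ) : ℂ)‖ₑ = weight t := by
      rw [weight, ← ofReal_norm, Complex.norm_of_nonneg (by positivity)]
    simp only [Pi.mul_apply, enorm_smul, h1]
    rw [← weight]
    ring

theorem integrable_weight_inner (G : (Ω.field u).L2) {F : Ω.ModelSpace u}
    (hF : F ∈ (Ω.modelField u).mulDomain) :
    Integrable (fun t : ℝ => ((1 + t ^ 2 : ℝ) : ℂ) * ⟪G.fn t, F.fn t⟫_ℂ) (Ω.control u) := by
  simpa only [inner_smul_right] using
    (Ω.field u).integrable_inner G.fn_mem (Ω.weight_smul_mem_preL2 u hF)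

/-- The domain of the restricted operator: all `F` in the domain of the multiplication operator with
`∫ (1 + t²) (ξ(t), F(t)) dμ(t) = 0` for all `ξ ∈ Λ(N)`. -/
def restrictedDomain : Submodule ℂ (Ω.ModelSpace u) where
  carrier := {F | F ∈ (Ω.modelOp u).domain ∧
    ∀ ξ : N, ∫ t, ((1 + t ^ 2 : ℝ) : ℂ) * ⟪(Ω.Lam u ξ).fn t, F.fn t⟫_ℂ ∂(Ω.control u) = 0}
  add_mem' := by
    rintro F G ⟨hF, hF'⟩ ⟨hG, hG'⟩
    refine ⟨Submodule.add_mem _ hF hG, fun ξ => ?_⟩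
    rw [← add_zero (0 : ℂ)]
    nth_rewrite 2 [← hF' ξ]
    rw [← hG' ξ, ← integral_add (Ω.integrable_weight_inner u _ hG)
      (Ω.integrable_weight_inner u _ hF)]
    refine integral_congr_ae ?_
    filter_upwards [(Ω.control_absolutelyContinuous u).ae_le
      (MeasurableField.L2.fn_add F G)] with t ht
    rw [ht, inner_add_right, mul_add, add_comm]
  zero_mem' := by
    refine ⟨Submodule.zero_mem _, fun ξ => ?_⟩
    refine integral_eq_zero_of_ae ?_
    filter_upwards [(Ω.control_absolutelyContinuous u).ae_le
      (MeasurableField.L2.fn_zero (M := Ω.modelField u))] with t ht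
    rw [ht]
    simp
  smul_mem' := by
    rintro c F ⟨hF, hF'⟩
    refine ⟨Submodule.smul_mem _ c hF, fun ξ => ?_⟩
    rw [← mul_zero c, ← hF' ξ, ← integral_const_mul]
    refine integral_congr_ae ?_
    filter_upwards [(Ω.control_absolutelyContinuous u).ae_le
      (MeasurableField.L2.fn_smul c F)] with t ht
    rw [ht, inner_smul_right]
    ring

/-- The restriction of the multiplication operator to `restrictedDomain`. -/
noncomputable def restrictedOp : Ω.ModelSpace u →ₗ.[ℂ] Ω.ModelSpace u :=
  (Ω.modelOp u).domRestrict (Ω.restrictedDomain u)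

/-- The sections `t ↦ (t - z)⁻¹ uₙ` belong to the model space. -/
theorem resolvent_mem_preL2 (z : ℂ) (hz : z.im ≠ 0) (n : I) :
   (fun t : ℝ => ((t:ℂ) - z)⁻¹ • (Ω.field u).e n t) ∈ (Ω.modelField u).preL2 := by
  have hb : ∀ t : ℝ, (1 + t^2) * ‖((t:ℂ)-z)⁻¹‖^2 ≤ 2 + (1+2*z.re^2)/z.im^2 := by
    intro t
    have h1 : ‖(t:ℂ)-z‖^2 = (t-z.re)^2 + z.im^2 := by
      rw [← Complex.normSq_eq_norm_sq, Complex.normSq_apply]; simp; ring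
    have h2 : 0 < z.im^2 := by positivity
    rw [norm_inv, inv_pow, h1, ← div_eq_mul_inv, div_le_iff₀ (by positivity)]
    have h3 : (2 + (1+2*z.re^2)/z.im^2) * ((t-z.re)^2 + z.im^2) = 2*(t-z.re)^2 + 2*z.im^2 + (1+2*z.re^2) + (1+2*z.re^2)/z.im^2*(t-z.re)^2 := by
      field_simp; ring
    rw [h3]
    have : 0 ≤ (1+2*z.re^2)/z.im^2*(t-z.re)^2 := by positivity
    nlinarith [sq_nonneg (t - 2*z.re)]
  have hE := e_mem_preL2 u Ω n
  have hw : Measurable weight := by unfold weight; fun_prop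
  have hc : Measurable (fun t : ℝ => ((t:ℂ) - z)⁻¹) := by fun_prop
  have hs : (fun t : ℝ => ((t:ℂ) - z)⁻¹ • (Ω.field u).e n t) ∈ (Ω.field u).sections := by
    intro m
    simp only [inner_smul_right]
    exact hc.aemeasurable.mul (hE.1 m)
  refine ⟨fun m => (hs m).mono_ac (withDensity_absolutelyContinuous _ _), ?_⟩
  rw [lintegral_withDensity_eq_lintegral_mul₀ hw.aemeasurable (((Ω.field u).aemeasurable_enorm hs).pow_const 2)]
  refine lt_of_le_of_lt (b := ∫⁻ t, ENNReal.ofReal (2 + (1+2*z.re^2)/z.im^2) * ‖(Ω.field u).e n t‖ₑ^2 ∂(Ω.control u)) (lintegral_mono fun t => ?_) ?_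
  · simp only [Pi.mul_apply, enorm_smul, mul_pow, ← mul_assoc]
    gcongr
    rw [weight, ← ofReal_norm, ← ENNReal.ofReal_pow (norm_nonneg _), ← ENNReal.ofReal_mul (by positivity)]
    exact ENNReal.ofReal_le_ofReal (hb t)
  · rw [lintegral_const_mul' _ _ (by simp)]
    exact ENNReal.mul_lt_top (by simp) hE.2

/-- The elements of the model space represented by some `t ↦ (t - z)⁻¹ uₙ`. -/
def resolventVectors (z : ℂ) : Set (Ω.ModelSpace u) :=
  {F | ∃ n : I, ∀ᵐ t ∂((Ω.control u).withDensity weight),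
    F.fn t = ((t : ℂ) - z)⁻¹ • (Ω.field u).e n t}

end PositiveOperatorMeasure

/-- The dimension of a separable complex Hilbert space, as an element of `ℕ ∪ {∞}`. -/
noncomputable def hilbertDim (H : Type*) [AddCommGroup H] [Module ℂ H] : ℕ∞ :=
  Cardinal.toENat (Module.rank ℂ H)

/-- The kernel `ker (T - z)` of an unbounded operator `T` shifted by `z`. -/
def kerShift {H : Type*} [AddCommGroup H] [Module ℂ H] (T : H →ₗ.[ℂ] H) (z : ℂ) : Submodule ℂ H :=
  (LinearMap.ker (T.toFun - z • T.domain.subtype)).map T.domain.subtype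

/-- The deficiency indices `(dim ker (T* - i), dim ker (T* + i))`. -/
noncomputable def deficiencyIndices {H : Type*} [NormedAddCommGroup H] [InnerProductSpace ℂ H]
    [CompleteSpace H] (T : H →ₗ.[ℂ] H) : ℕ∞ × ℕ∞ :=
  (hilbertDim (kerShift T.adjoint Complex.I), hilbertDim (kerShift T.adjoint (-Complex.I)))

/-! Write `R(z)` for multiplication by `(t - z)⁻¹`. Since `(1 + t²)|t - z|⁻²` is bounded above and
below for nonreal `z`, this multiplication is an isomorphism from `L²(dΩ̃)` onto `L²((1 + t²) dΩ̃)`.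
Composing it with `Λ` gives `D_z ξ = (t - z)⁻¹ Λξ` (`deficiencyMap`), which embeds `N` in the model
space.

Because `conj ((t - z)⁻¹) (t - z̄) = 1`, the side condition on `F` says exactly that `(Ĥ - z̄)F` is
orthogonal to `ran D_z` (`mem_restrictedDomain_iff`). So the restricted domain is `R(z̄)(ran D_z)ᗮ`,
and the restricted operator minus `z̄` has range `(ran D_z)ᗮ`. Closedness can be read off from this
description. The kernel of the adjoint minus `z` is `(ran D_z)ᗮᗮ`. The normalization `Ω̃(ℝ) = I`
makes `Λ` isometric, hence `ran D_z` is closed and `D_z` injective: the kernel is `ran D_z`, a copy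
of `N`, and it is the closed span of the images of the basis. Symmetry is inherited from
multiplication by a real variable.

Density is where the divergence hypothesis enters. If `G` is orthogonal to the restricted domain,
then `R(z)G` lies in `(ran D_z)ᗮᗮ = ran D_z`, so `G = Λξ` almost everywhere for some `ξ`. The
identity `d(ξ, Ω̃ξ) = ‖Λξ(t)‖² dμ` (`scalarMeasure_eq_withDensity`), which comes from `Λ* 1_B Λ =
Ω̃(B)`, turns the finite model norm of `G` into `∫ (1 + t²) d(ξ, Ω̃ξ) < ∞`. Hence `ξ = 0` and `G =
0`. -/

namespace MeasurableField

variable {ι : Type*} {K : ℝ → Type*} [∀ t, NormedAddCommGroup (K t)]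
  [∀ t, InnerProductSpace ℂ (K t)] {μ ν : Measure ℝ}

/-! ### Norms and bounded multiplication operators between `L²` spaces of sections. -/

theorem L2.norm_sq [Countable ι] {M : MeasurableField ι K μ} (F : M.L2) :
    ‖F‖ ^ 2 = ∫ t, ‖F.fn t‖ ^ 2 ∂μ := by
  have := inner_self_eq_norm_sq_to_K (𝕜 := ℂ) F
  rw [L2.inner_def, integral_inner_self] at this
  exact (Complex.ofReal_injective (by simpa using this)).symm

theorem L2.enorm_sq [Countable ι] {M : MeasurableField ι K μ} (F : M.L2) :
    ‖F‖ₑ ^ 2 = ∫⁻ t, ‖F.fn t‖ₑ ^ 2 ∂μ := by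
  rw [← M.ofReal_integral_norm_sq F.fn_mem, ← L2.norm_sq, ENNReal.ofReal_pow (norm_nonneg _),
    ofReal_norm]

theorem L2.fn_sub [Countable ι] {M : MeasurableField ι K μ} (F G : M.L2) :
    ∀ᵐ t ∂μ, (F - G).fn t = F.fn t - G.fn t := by
  rw [sub_eq_add_neg, ← neg_one_smul ℂ G]
  filter_upwards [L2.fn_add F ((-1 : ℂ) • G), L2.fn_smul (-1 : ℂ) G] with t h1 h2
  rw [h1, h2, neg_one_smul, sub_eq_add_neg]

/-- Data making multiplication by `φ` bounded from `L²(M; dμ)` to `L²(M'; dν)`. -/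
structure IsMultiplier (M : MeasurableField ι K μ) (M' : MeasurableField ι K ν) (φ : ℝ → ℂ)
    (C : NNReal) : Prop where
  e_eq : M'.e = M.e
  ac : ν ≪ μ
  measurable : Measurable φ
  le : ν.withDensity (fun t => ‖φ t‖ₑ ^ 2) ≤ (C : ℝ≥0∞) • μ

namespace IsMultiplier

variable {M : MeasurableField ι K μ} {M' : MeasurableField ι K ν} {φ : ℝ → ℂ}
  {C : NNReal}

theorem smul_mem_sections (h : IsMultiplier M M' φ C) {f : ∀ t, K t} (hf : f ∈ M.sections) :
    (fun t => φ t • f t) ∈ M'.sections := by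
  intro n
  simp only [inner_smul_right, h.e_eq]
  exact h.measurable.aemeasurable.mul ((hf n).mono_ac h.ac)

variable [Countable ι]

/-- The factor `‖φ‖²` is absorbed into the measure `ν`, after which the domination of measures in
`IsMultiplier` applies directly. -/
theorem lintegral_le (h : IsMultiplier M M' φ C) {f : ∀ t, K t} (hf : f ∈ M.sections) :
    ∫⁻ t, ‖φ t • f t‖ₑ ^ 2 ∂ν ≤ C * ∫⁻ t, ‖f t‖ₑ ^ 2 ∂μ := by
  have hφ := h.measurable
  have hm := (M.aemeasurable_enorm hf).pow_const 2
  calc ∫⁻ t, ‖φ t • f t‖ₑ ^ 2 ∂ν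
      = ∫⁻ t, ‖f t‖ₑ ^ 2 ∂(ν.withDensity fun t => ‖φ t‖ₑ ^ 2) := by
        rw [lintegral_withDensity_eq_lintegral_mul₀ (by fun_prop) (hm.mono_ac h.ac)]
        simp [enorm_smul, mul_pow]
    _ ≤ ∫⁻ t, ‖f t‖ₑ ^ 2 ∂((C : ℝ≥0∞) • μ) := lintegral_mono' h.le le_rfl
    _ = _ := by rw [lintegral_smul_measure, smul_eq_mul]

theorem smul_mem_preL2 (h : IsMultiplier M M' φ C) {f : ∀ t, K t} (hf : f ∈ M.preL2) :
    (fun t => φ t • f t) ∈ M'.preL2 :=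
  ⟨h.smul_mem_sections hf.1,
    (h.lintegral_le hf.1).trans_lt (ENNReal.mul_lt_top ENNReal.coe_lt_top hf.2)⟩

theorem norm_mk_le (h : IsMultiplier M M' φ C) (F : M.L2) :
    ‖L2.mk (fun t => φ t • F.fn t) (h.smul_mem_preL2 F.fn_mem)‖ ≤ Real.sqrt C * ‖F‖ := by
  refine abs_le_of_sq_le_sq' ?_ (by positivity) |>.2
  rw [mul_pow, Real.sq_sqrt C.coe_nonneg, ← ENNReal.ofReal_le_ofReal_iff (by positivity),
    ENNReal.ofReal_mul C.coe_nonneg, ENNReal.ofReal_pow (norm_nonneg _),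
    ENNReal.ofReal_pow (norm_nonneg _), ofReal_norm, ofReal_norm, L2.enorm_sq, L2.enorm_sq,
    ENNReal.ofReal_coe_nnreal]
  refine le_trans (le_of_eq (lintegral_congr_ae ?_)) (h.lintegral_le F.fn_mem.1)
  filter_upwards [L2.fn_mk (h.smul_mem_preL2 F.fn_mem)] with t ht
  rw [ht]

/-- The bounded operator of multiplication by `φ`. -/
noncomputable def toCLM (h : IsMultiplier M M' φ C) : M.L2 →L[ℂ] M'.L2 :=
  LinearMap.mkContinuous
    { toFun := fun F => L2.mk (fun t => φ t • F.fn t) (h.smul_mem_preL2 F.fn_mem)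
      map_add' := by
        intro F G
        rw [← L2.mk_add, L2.mk_eq_mk]
        filter_upwards [h.ac.ae_le (L2.fn_add F G)] with t ht
        simp [ht]
      map_smul' := by
        intro c F
        rw [RingHom.id_apply, ← L2.mk_smul, L2.mk_eq_mk]
        filter_upwards [h.ac.ae_le (L2.fn_smul c F)] with t ht
        simp [ht, smul_comm (φ t) c] }
    (Real.sqrt C) h.norm_mk_le

theorem fn_toCLM (h : IsMultiplier M M' φ C) (F : M.L2) :
    ∀ᵐ t ∂ν, (h.toCLM F).fn t = φ t • F.fn t :=
  L2.fn_mk (h.smul_mem_preL2 F.fn_mem)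

end IsMultiplier

/-- Multiplication by the indicator function of a Borel set is bounded. -/
theorem isMultiplier_indicator (M : MeasurableField ι K μ) {B : Set ℝ} (hB : MeasurableSet B) :
    IsMultiplier M M (B.indicator 1) 1 where
  e_eq := rfl
  ac := Measure.AbsolutelyContinuous.rfl
  measurable := measurable_one.indicator hB
  le := by
    rw [ENNReal.coe_one, one_smul]
    conv_rhs => rw [← withDensity_one (μ := μ)]
    refine withDensity_mono (ae_of_all _ fun t => ?_)
    by_cases ht : t ∈ B <;> simp [ht]

end MeasurableField

/-! ### Two-sided comparison of `1 + t²` with `|t - z|²`. -/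

theorem one_add_sq_le {z : ℂ} (hz : z.im ≠ 0) (t : ℝ) :
    1 + t ^ 2 ≤ (2 + (1 + 2 * z.re ^ 2) / z.im ^ 2) * ‖(t : ℂ) - z‖ ^ 2 := by
  have h1 : ‖(t : ℂ) - z‖ ^ 2 = (t - z.re) ^ 2 + z.im ^ 2 := by
    rw [← Complex.normSq_eq_norm_sq, Complex.normSq_apply]; simp; ring
  have h3 : (2 + (1 + 2 * z.re ^ 2) / z.im ^ 2) * ((t - z.re) ^ 2 + z.im ^ 2) =
      2 * (t - z.re) ^ 2 + 2 * z.im ^ 2 + (1 + 2 * z.re ^ 2)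
        + (1 + 2 * z.re ^ 2) / z.im ^ 2 * (t - z.re) ^ 2 := by
    field_simp; ring
  have : 0 ≤ (1 + 2 * z.re ^ 2) / z.im ^ 2 * (t - z.re) ^ 2 := by positivity
  rw [h1, h3]
  -- With `a = Re z`, the inequality `t² ≤ 2(t - a)² + 2a²` is `(t - 2a)² ≥ 0`. The quotient in the
  -- constant is chosen so that its product with `(Im z)²` supplies `1 + 2a²`; the remaining terms
  -- are nonnegative.
  nlinarith [sq_nonneg (t - 2 * z.re), sq_nonneg z.im]

theorem norm_sub_sq_le (z : ℂ) (t : ℝ) :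
    ‖(t : ℂ) - z‖ ^ 2 ≤ 2 * (1 + ‖z‖ ^ 2) * (1 + t ^ 2) := by
  have h1 := norm_sub_le (t : ℂ) z
  have h2 : ‖(t : ℂ)‖ ^ 2 = t ^ 2 := by simp
  have h3 : ‖(t : ℂ) - z‖ ^ 2 ≤ (‖(t : ℂ)‖ + ‖z‖) ^ 2 := by gcongr
  -- This is `(|t| + |z|)² ≤ 2t² + 2|z|²`, bounded by the product with the extra terms `2` and
  -- `2|z|²t²` discarded.
  nlinarith [sq_nonneg (‖(t : ℂ)‖ - ‖z‖), sq_nonneg (‖z‖ * t), mul_pow ‖z‖ t 2]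

theorem ofReal_sub_ne_zero {z : ℂ} (hz : z.im ≠ 0) (t : ℝ) : (t : ℂ) - z ≠ 0 := by
  intro h
  apply hz
  simpa using congrArg Complex.im h

theorem enorm_sq_eq_ofReal (x : ℂ) : ‖x‖ₑ ^ 2 = ENNReal.ofReal (‖x‖ ^ 2) := by
  rw [ENNReal.ofReal_pow (norm_nonneg _), ofReal_norm]

theorem one_add_sq_mul_norm_inv_sq_le {z : ℂ} (hz : z.im ≠ 0) (t : ℝ) :
    (1 + t ^ 2) * ‖((t : ℂ) - z)⁻¹‖ ^ 2 ≤ 2 + (1 + 2 * z.re ^ 2) / z.im ^ 2 := by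
  have h0 : 0 < ‖(t : ℂ) - z‖ := norm_pos_iff.2 (ofReal_sub_ne_zero hz t)
  rw [norm_inv, inv_pow, ← div_eq_mul_inv, div_le_iff₀ (by positivity)]
  exact one_add_sq_le hz t

/-! ### Multiplication by `(t - z)⁻¹`, as resolvent and as isomorphism of the two `L²` spaces. -/

namespace PositiveOperatorMeasure

variable {N : Type*} [NormedAddCommGroup N] [InnerProductSpace ℂ N]
  {I : Set ℕ} (u : HilbertBasis I ℂ N) (Ω : PositiveOperatorMeasure N)

theorem measurable_weight : Measurable weight := by unfold weight; fun_prop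

/-- A bound for `(1 + t²) |t - z|⁻²`. -/
noncomputable def resolventBound (z : ℂ) : NNReal :=
  Real.toNNReal (2 + (1 + 2 * z.re ^ 2) / z.im ^ 2)

theorem weight_mul_le {z : ℂ} (hz : z.im ≠ 0) (t : ℝ) :
    weight t * ‖((t : ℂ) - z)⁻¹‖ₑ ^ 2 ≤ resolventBound z := by
  rw [weight, enorm_sq_eq_ofReal, ← ENNReal.ofReal_mul (by positivity)]
  exact ENNReal.ofReal_le_ofReal (one_add_sq_mul_norm_inv_sq_le hz t)

theorem one_le_weight (t : ℝ) : 1 ≤ weight t := by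
  rw [weight, ENNReal.one_le_ofReal]
  nlinarith [sq_nonneg t]

theorem isMultiplier_resolvent {z : ℂ} (hz : z.im ≠ 0) :
    MeasurableField.IsMultiplier (Ω.modelField u) (Ω.modelField u)
      (fun t : ℝ => ((t : ℂ) - z)⁻¹) (resolventBound z) where
  e_eq := rfl
  ac := Measure.AbsolutelyContinuous.rfl
  measurable := by fun_prop
  le := by
    rw [← withDensity_const]
    refine withDensity_mono (ae_of_all _ fun t => ?_)
    refine le_trans ?_ (weight_mul_le hz t)
    -- Source and target carry the same measure here, so no weight is needed; as the weight is at
    -- least `1`, the stronger weighted bound still provides the constant.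
    exact le_mul_of_one_le_left' (one_le_weight t)

/-- The decay of `|t - z|⁻²` compensates the weight `1 + t²` of the target measure. -/
theorem isMultiplier_field_model {z : ℂ} (hz : z.im ≠ 0) :
    MeasurableField.IsMultiplier (Ω.field u) (Ω.modelField u)
      (fun t : ℝ => ((t : ℂ) - z)⁻¹) (resolventBound z) where
  e_eq := rfl
  ac := withDensity_absolutelyContinuous _ _
  measurable := by fun_prop
  le := by
    rw [← withDensity_const, ← withDensity_mul _ measurable_weight (by fun_prop)]
    exact withDensity_mono (ae_of_all _ fun t => weight_mul_le hz t)

/-- Growth of `|t - z|²` is paid for by the weight in the source norm. This provides the bounded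
inverse of multiplication by `(t - z)⁻¹`. -/
theorem isMultiplier_model_field (z : ℂ) :
    MeasurableField.IsMultiplier (Ω.modelField u) (Ω.field u)
      (fun t : ℝ => (t : ℂ) - z) (Real.toNNReal (2 * (1 + ‖z‖ ^ 2))) where
  e_eq := rfl
  ac := Ω.control_absolutelyContinuous u
  measurable := by fun_prop
  le := by
    rw [← withDensity_smul _ measurable_weight]
    refine withDensity_mono (ae_of_all _ fun t => ?_)
    beta_reduce
    rw [Pi.smul_apply, smul_eq_mul, weight, enorm_sq_eq_ofReal, ← ENNReal.ofReal_coe_nnreal,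
      Real.coe_toNNReal _ (by positivity), ← ENNReal.ofReal_mul (by positivity)]
    exact ENNReal.ofReal_le_ofReal (norm_sub_sq_le z t)

/-- The resolvent of the multiplication operator. -/
noncomputable def modelResolvent {z : ℂ} (hz : z.im ≠ 0) : Ω.ModelSpace u →L[ℂ] Ω.ModelSpace u :=
  (Ω.isMultiplier_resolvent u hz).toCLM

/-- Multiplication by `(t - z)⁻¹` as an isomorphism `L²(ℝ, N; dΩ̃) → L²(ℝ, N; dΩ)`. -/
noncomputable def resolventEquiv {z : ℂ} (hz : z.im ≠ 0) :
    (Ω.field u).L2 ≃L[ℂ] Ω.ModelSpace u :=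
  ContinuousLinearEquiv.equivOfInverse (Ω.isMultiplier_field_model u hz).toCLM
    (Ω.isMultiplier_model_field u z).toCLM
    (by
      intro F
      apply MeasurableField.L2.ext_ae
      filter_upwards [(Ω.isMultiplier_model_field u z).fn_toCLM
          ((Ω.isMultiplier_field_model u hz).toCLM F),
        (Ω.control_absolutelyContinuous u).ae_le ((Ω.isMultiplier_field_model u hz).fn_toCLM F)]
        with t h1 h2
      rw [h1, h2, smul_smul, mul_inv_cancel₀ (ofReal_sub_ne_zero hz t), one_smul])
    (by
      intro F
      apply MeasurableField.L2.ext_ae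
      filter_upwards [(Ω.isMultiplier_field_model u hz).fn_toCLM
          ((Ω.isMultiplier_model_field u z).toCLM F),
        (withDensity_absolutelyContinuous (Ω.control u) weight).ae_le
          ((Ω.isMultiplier_model_field u z).fn_toCLM F)] with t h1 h2
      rw [h1, h2, smul_smul, inv_mul_cancel₀ (ofReal_sub_ne_zero hz t), one_smul])

theorem fn_resolventEquiv {z : ℂ} (hz : z.im ≠ 0) (F : (Ω.field u).L2) :
    ∀ᵐ t ∂((Ω.control u).withDensity weight),
      (Ω.resolventEquiv u hz F).fn t = ((t : ℂ) - z)⁻¹ • F.fn t :=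
  (Ω.isMultiplier_field_model u hz).fn_toCLM F

theorem fn_modelResolvent {z : ℂ} (hz : z.im ≠ 0) (F : Ω.ModelSpace u) :
    ∀ᵐ t ∂((Ω.control u).withDensity weight),
      (Ω.modelResolvent u hz F).fn t = ((t : ℂ) - z)⁻¹ • F.fn t :=
  (Ω.isMultiplier_resolvent u hz).fn_toCLM F

end PositiveOperatorMeasure

/-! ### Indicator operators and the deficiency vectors. -/

namespace PositiveOperatorMeasure

variable {N : Type*} [NormedAddCommGroup N] [InnerProductSpace ℂ N]
  {I : Set ℕ} (u : HilbertBasis I ℂ N) (Ω : PositiveOperatorMeasure N)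

/-- Multiplication by the indicator function of `B` in `L²(ℝ, N; dΩ̃)`. -/
noncomputable def indicatorOp {B : Set ℝ} (hB : MeasurableSet B) :
    (Ω.field u).L2 →L[ℂ] (Ω.field u).L2 :=
  ((Ω.field u).isMultiplier_indicator hB).toCLM

theorem fn_indicatorOp {B : Set ℝ} (hB : MeasurableSet B) (F : (Ω.field u).L2) :
    ∀ᵐ t ∂(Ω.control u), (Ω.indicatorOp u hB F).fn t = B.indicator (1 : ℝ → ℂ) t • F.fn t :=
  ((Ω.field u).isMultiplier_indicator hB).fn_toCLM F

theorem inner_indicatorOp {B : Set ℝ} (hB : MeasurableSet B) (F G : (Ω.field u).L2) :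
    ⟪F, Ω.indicatorOp u hB G⟫_ℂ = ∫ t in B, ⟪F.fn t, G.fn t⟫_ℂ ∂(Ω.control u) := by
  rw [MeasurableField.L2.inner_def, ← integral_indicator hB]
  refine integral_congr_ae ?_
  filter_upwards [Ω.fn_indicatorOp u hB G] with t ht
  rw [ht]
  by_cases h : t ∈ B <;> simp [h]

/-- On basis vectors `Λ` gives constant sections, whose fibre inner products are the Radon–Nikodym
derivatives `φₘₙ`; integrating these over `B` recovers the matrix elements. -/
theorem inner_Lam_indicatorOp_basis {B : Set ℝ} (hB : MeasurableSet B) (m n : I) :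
    ⟪Ω.Lam u (u m), Ω.indicatorOp u hB (Ω.Lam u (u n))⟫_ℂ = ⟪u m, Ω.toFun B (u n)⟫_ℂ := by
  rw [inner_indicatorOp, ← setIntegral_density u Ω m n hB, Lam_basis, Lam_basis]
  refine integral_congr_ae (ae_restrict_of_ae ?_)
  filter_upwards [MeasurableField.L2.fn_mk (Ω.e_mem_preL2 u n),
    MeasurableField.L2.fn_mk (Ω.e_mem_preL2 u m), Ω.ae_gram_eq u] with t h1 h2 h3
  rw [h1, h2]
  exact (GramSpace.inner_basisVec _ m n).trans (h3 m n)

/-- The vectors `(t - z)⁻¹ Λξ`, as a bounded operator of `ξ`. -/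
noncomputable def deficiencyMap {z : ℂ} (hz : z.im ≠ 0) : N →L[ℂ] Ω.ModelSpace u :=
  (Ω.resolventEquiv u hz : (Ω.field u).L2 →L[ℂ] Ω.ModelSpace u) ∘L Ω.Lam u

theorem fn_deficiencyMap {z : ℂ} (hz : z.im ≠ 0) (ξ : N) :
    ∀ᵐ t ∂((Ω.control u).withDensity weight),
      (Ω.deficiencyMap u hz ξ).fn t = ((t : ℂ) - z)⁻¹ • (Ω.Lam u ξ).fn t :=
  Ω.fn_resolventEquiv u hz _

/-- This replaces the vectors `(t - z)⁻¹ uₙ` by images of the basis under one bounded operator, so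
that their closed span can be computed in `N`. -/
theorem resolventVectors_eq_range {z : ℂ} (hz : z.im ≠ 0) :
    Ω.resolventVectors u z = Set.range fun n => Ω.deficiencyMap u hz (u n) := by
  have hn : ∀ n, ∀ᵐ t ∂((Ω.control u).withDensity weight),
      (Ω.deficiencyMap u hz (u n)).fn t = ((t : ℂ) - z)⁻¹ • (Ω.field u).e n t := by
    intro n
    filter_upwards [Ω.fn_deficiencyMap u hz (u n),
      (withDensity_absolutelyContinuous (Ω.control u) weight).ae_le
        (MeasurableField.L2.fn_mk (Ω.e_mem_preL2 u n))] with t h1 h2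
    rw [h1, Lam_basis, h2]
  ext F
  constructor
  · rintro ⟨n, hF⟩
    refine ⟨n, MeasurableField.L2.ext_ae ?_⟩
    filter_upwards [hF, hn n] with t h1 h2
    rw [h1, h2]
  · rintro ⟨n, rfl⟩
    exact ⟨n, hn n⟩

/-! ### The multiplication operator and its resolvent. -/

/-- The range of the resolvent is the domain of the multiplication operator. -/
theorem modelResolvent_mem {z : ℂ} (hz : z.im ≠ 0) (G : Ω.ModelSpace u) :
    Ω.modelResolvent u hz G ∈ (Ω.modelOp u).domain := by
  refine ⟨fun n => ((Ω.modelResolvent u hz G).fn_mem.1 n).mono_ac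
    (withDensity_absolutelyContinuous _ _), ?_⟩
  have hw := measurable_weight
  have hG := ((Ω.modelField u).aemeasurable_enorm G.fn_mem.1).pow_const 2
  rw [lintegral_withDensity_eq_lintegral_mul₀ (by fun_prop)
    (((Ω.modelField u).aemeasurable_enorm (Ω.modelResolvent u hz G).fn_mem.1).pow_const 2)]
  refine lt_of_le_of_lt ?_
    (ENNReal.mul_lt_top (ENNReal.coe_lt_top (r := resolventBound z)) G.fn_mem.2)
  rw [← lintegral_const_mul'' _ hG]
  refine lintegral_mono_ae ?_
  filter_upwards [Ω.fn_modelResolvent u hz G] with t ht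
  rw [Pi.mul_apply, ht, enorm_smul, mul_pow, ← mul_assoc]
  gcongr
  exact weight_mul_le hz t

theorem fn_modelOp (F : (Ω.modelOp u).domain) : ∀ᵐ t ∂((Ω.control u).withDensity weight),
    (Ω.modelOp u F).fn t = (t : ℂ) • (F : Ω.ModelSpace u).fn t :=
  MeasurableField.L2.fn_mk ((Ω.modelField u).mul_mem_preL2 F.2)

theorem fn_modelOp_sub (F : (Ω.modelOp u).domain) (z : ℂ) :
    ∀ᵐ t ∂((Ω.control u).withDensity weight),
      (Ω.modelOp u F - z • (F : Ω.ModelSpace u)).fn t =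
        ((t : ℂ) - z) • (F : Ω.ModelSpace u).fn t := by
  filter_upwards [Ω.fn_modelOp u F, MeasurableField.L2.fn_sub (Ω.modelOp u F) (z • (F : Ω.ModelSpace u)),
    MeasurableField.L2.fn_smul z (F : Ω.ModelSpace u)] with t h1 h2 h3
  rw [h2, h3, h1, sub_smul]

theorem modelResolvent_modelOp_sub {z : ℂ} (hz : z.im ≠ 0) (F : (Ω.modelOp u).domain) :
    Ω.modelResolvent u hz (Ω.modelOp u F - z • (F : Ω.ModelSpace u)) = F := by
  apply MeasurableField.L2.ext_ae
  filter_upwards [Ω.fn_modelResolvent u hz (Ω.modelOp u F - z • (F : Ω.ModelSpace u)),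
    Ω.fn_modelOp_sub u F z] with t h1 h2
  rw [h1, h2, smul_smul, inv_mul_cancel₀ (ofReal_sub_ne_zero hz t), one_smul]

theorem modelOp_sub_modelResolvent {z : ℂ} (hz : z.im ≠ 0) (G : Ω.ModelSpace u) :
    Ω.modelOp u ⟨Ω.modelResolvent u hz G, Ω.modelResolvent_mem u hz G⟩
      - z • Ω.modelResolvent u hz G = G := by
  apply MeasurableField.L2.ext_ae
  filter_upwards [Ω.fn_modelResolvent u hz G,
    Ω.fn_modelOp_sub u ⟨Ω.modelResolvent u hz G, Ω.modelResolvent_mem u hz G⟩ z] with t h1 h2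
  rw [h2, h1, smul_smul, mul_inv_cancel₀ (ofReal_sub_ne_zero hz t), one_smul]

theorem modelOp_isFormalAdjoint : (Ω.modelOp u).IsFormalAdjoint (Ω.modelOp u) := by
  intro F G
  rw [MeasurableField.L2.inner_def, MeasurableField.L2.inner_def]
  refine integral_congr_ae ?_
  filter_upwards [Ω.fn_modelOp u F, Ω.fn_modelOp u G] with t h1 h2
  rw [h1, h2, inner_smul_left, inner_smul_right, Complex.conj_ofReal]

/-- The fibrewise factors `(t - z)⁻¹` and `(t - z̄)⁻¹` are complex conjugates for real `t`, so
`R(z)* = R(z̄)`. -/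
theorem inner_modelResolvent {z : ℂ} (hz : z.im ≠ 0) (hz' : (conj z).im ≠ 0)
    (F G : Ω.ModelSpace u) :
    ⟪F, Ω.modelResolvent u hz' G⟫_ℂ = ⟪Ω.modelResolvent u hz F, G⟫_ℂ := by
  rw [MeasurableField.L2.inner_def, MeasurableField.L2.inner_def]
  refine integral_congr_ae ?_
  filter_upwards [Ω.fn_modelResolvent u hz F, Ω.fn_modelResolvent u hz' G] with t h1 h2
  rw [h1, h2, inner_smul_left, inner_smul_right, map_inv₀, map_sub, Complex.conj_ofReal]

/-! ### The restricted operator: orthogonality, symmetry and closedness. -/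

/-- The side condition in `restrictedDomain` as orthogonality in the model space. -/
theorem integral_weight_inner_Lam {z : ℂ} (hz : z.im ≠ 0) (F : (Ω.modelOp u).domain) (ξ : N) :
    ∫ t, ((1 + t ^ 2 : ℝ) : ℂ) * ⟪(Ω.Lam u ξ).fn t, (F : Ω.ModelSpace u).fn t⟫_ℂ ∂(Ω.control u) =
      ⟪Ω.deficiencyMap u hz ξ, Ω.modelOp u F - conj z • (F : Ω.ModelSpace u)⟫_ℂ := by
  have h1 : ∀ᵐ t ∂((Ω.control u).withDensity weight),
      ⟪(Ω.deficiencyMap u hz ξ).fn t,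
        (Ω.modelOp u F - conj z • (F : Ω.ModelSpace u)).fn t⟫_ℂ =
      ⟪(Ω.Lam u ξ).fn t, (F : Ω.ModelSpace u).fn t⟫_ℂ := by
    filter_upwards [Ω.fn_deficiencyMap u hz ξ, Ω.fn_modelOp_sub u F (conj z)] with t h1 h2
    -- The conjugated factor `(t - z)⁻¹` from the first slot cancels `t - z̄` from the second; the
    -- weight `1 + t²` then comes only from the model measure.
    have h3 : conj ((t : ℂ) - z) = (t : ℂ) - conj z := by rw [map_sub, Complex.conj_ofReal]
    rw [h1, h2, inner_smul_left, inner_smul_right, ← mul_assoc, ← h3, ← map_mul,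
      inv_mul_cancel₀ (ofReal_sub_ne_zero hz t), map_one, one_mul]
  rw [MeasurableField.L2.inner_def, integral_congr_ae h1,
    integral_withDensity_eq_integral_toReal_smul measurable_weight
      (ae_of_all _ fun t => ENNReal.ofReal_lt_top)]
  refine integral_congr_ae (ae_of_all _ fun t => ?_)
  simp only [weight]
  rw [ENNReal.toReal_ofReal (by positivity), Complex.real_smul]

/-- The pivot of the argument: for each nonreal `z`, the domain condition becomes orthogonality to a
fixed subspace, tested after applying `Ĥ - z̄`. -/
theorem mem_restrictedDomain_iff {z : ℂ} (hz : z.im ≠ 0) (F : (Ω.modelOp u).domain) :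
    (F : Ω.ModelSpace u) ∈ Ω.restrictedDomain u ↔
      Ω.modelOp u F - conj z • (F : Ω.ModelSpace u) ∈ (Ω.deficiencyMap u hz).rangeᗮ := by
  rw [Submodule.mem_orthogonal]
  constructor
  · rintro ⟨-, h⟩ _ ⟨ξ, rfl⟩
    exact (Ω.integral_weight_inner_Lam u hz F ξ).symm.trans (h ξ)
  · intro h
    exact ⟨F.2, fun ξ => (Ω.integral_weight_inner_Lam u hz F ξ).trans (h _ ⟨ξ, rfl⟩)⟩

/-- `domRestrict` intersects the given subspace with the operator's domain; here the intersection
changes nothing, since membership in that domain is already part of the condition. -/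
theorem mem_domain_restrictedOp {F : Ω.ModelSpace u} :
    F ∈ (Ω.restrictedOp u).domain ↔ F ∈ Ω.restrictedDomain u :=
  ⟨fun h => h.1, fun h => ⟨h, h.1⟩⟩

theorem restrictedOp_apply (F : (Ω.restrictedOp u).domain) :
    Ω.restrictedOp u F = Ω.modelOp u ⟨F, F.2.2⟩ := rfl

theorem conj_im_ne_zero {z : ℂ} (hz : z.im ≠ 0) : (conj z).im ≠ 0 := by simpa using hz

/-- `R(z̄)` maps `{(t - z)⁻¹ Λξ}ᗮ` into the restricted domain. -/
theorem modelResolvent_mem_restrictedOp {z : ℂ} (hz : z.im ≠ 0) {G : Ω.ModelSpace u}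
    (hG : G ∈ (Ω.deficiencyMap u hz).rangeᗮ) :
    Ω.modelResolvent u (conj_im_ne_zero hz) G ∈ (Ω.restrictedOp u).domain := by
  rw [mem_domain_restrictedOp]
  refine (Ω.mem_restrictedDomain_iff u hz
    ⟨_, Ω.modelResolvent_mem u (conj_im_ne_zero hz) G⟩).2 ?_
  rwa [modelOp_sub_modelResolvent]

theorem restrictedOp_isFormalAdjoint :
    (Ω.restrictedOp u).IsFormalAdjoint (Ω.restrictedOp u) := fun F G =>
  Ω.modelOp_isFormalAdjoint u ⟨F, F.2.2⟩ ⟨G, G.2.2⟩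

/-- A pair `(F, K)` is determined by `K - z̄F`: the resolvent recovers `F` from it, and
orthogonality encodes the side condition. Only bounded operators occur on the right, so both
conditions are closed. -/
theorem mem_graph_restrictedOp_iff {z : ℂ} (hz : z.im ≠ 0) (p : Ω.ModelSpace u × Ω.ModelSpace u) :
    p ∈ (Ω.restrictedOp u).graph ↔
      Ω.modelResolvent u (conj_im_ne_zero hz) (p.2 - conj z • p.1) = p.1 ∧
        p.2 - conj z • p.1 ∈ (Ω.deficiencyMap u hz).rangeᗮ := by
  rw [LinearPMap.mem_graph_iff]
  constructor
  · rintro ⟨F, h1, h2⟩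
    rw [← h1, ← h2, restrictedOp_apply]
    exact ⟨Ω.modelResolvent_modelOp_sub u (conj_im_ne_zero hz) ⟨F, F.2.2⟩,
      (Ω.mem_restrictedDomain_iff u hz ⟨F, F.2.2⟩).1 F.2.1⟩
  · rintro ⟨h1, h2⟩
    have h3 := Ω.modelResolvent_mem_restrictedOp u hz h2
    refine ⟨⟨_, h3⟩, h1, ?_⟩
    have h4 := Ω.modelOp_sub_modelResolvent u (conj_im_ne_zero hz) (p.2 - conj z • p.1)
    rw [sub_eq_iff_eq_add] at h4
    exact h4.trans (by rw [h1, sub_add_cancel])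

theorem restrictedOp_isClosed : (Ω.restrictedOp u).IsClosed := by
  -- Any nonreal point would serve equally well.
  have hz : Complex.I.im ≠ 0 := by simp
  have h1 : ((Ω.restrictedOp u).graph : Set (Ω.ModelSpace u × Ω.ModelSpace u)) =
      {p | Ω.modelResolvent u (conj_im_ne_zero hz) (p.2 - conj Complex.I • p.1) = p.1} ∩
        (fun p => p.2 - conj Complex.I • p.1) ⁻¹' ((Ω.deficiencyMap u hz).rangeᗮ : Set _) := by
    ext p
    exact Ω.mem_graph_restrictedOp_iff u hz p
  have h2 : Continuous fun p : Ω.ModelSpace u × Ω.ModelSpace u => p.2 - conj Complex.I • p.1 :=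
    continuous_snd.sub ((continuous_const_smul (conj Complex.I)).comp continuous_fst)
  rw [LinearPMap.IsClosed, h1]
  exact (isClosed_eq ((ContinuousLinearMap.continuous _).comp h2) continuous_fst).inter
    ((Submodule.isClosed_orthogonal _).preimage h2)

/-! ### Recovering the operator measure from `Λ`. -/

variable [CompleteSpace N]

/-- Both sides are bounded operators, so agreement of their matrix elements in the basis `u`
suffices. This carries the Radon–Nikodym identities from basis vectors to all of `N`. -/
theorem adjoint_Lam_indicatorOp_Lam {B : Set ℝ} (hB : MeasurableSet B) :
    (Ω.Lam u).adjoint ∘L Ω.indicatorOp u hB ∘L Ω.Lam u = Ω.toFun B := by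
  refine ContinuousLinearMap.ext_on
    ((Submodule.dense_iff_topologicalClosure_eq_top).2 u.dense_span) ?_
  rintro _ ⟨n, rfl⟩
  apply u.repr.injective
  ext m
  rw [u.repr_apply_apply, u.repr_apply_apply, ContinuousLinearMap.comp_apply,
    ContinuousLinearMap.adjoint_inner_right]
  exact Ω.inner_Lam_indicatorOp_basis u hB m n

/-- `∫_B (Λξ, Λη) dμ = (ξ, Ω(B) η)`. -/
theorem setIntegral_inner_Lam {B : Set ℝ} (hB : MeasurableSet B) (ξ η : N) :
    ∫ t in B, ⟪(Ω.Lam u ξ).fn t, (Ω.Lam u η).fn t⟫_ℂ ∂(Ω.control u) = ⟪ξ, Ω.toFun B η⟫_ℂ := by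
  rw [← Ω.inner_indicatorOp u hB, ← Ω.adjoint_Lam_indicatorOp_Lam u hB, ContinuousLinearMap.comp_apply,
    ContinuousLinearMap.adjoint_inner_right]
  rfl

theorem inner_Lam (h : Ω.toFun Set.univ = ContinuousLinearMap.id ℂ N) (ξ η : N) :
    ⟪Ω.Lam u ξ, Ω.Lam u η⟫_ℂ = ⟪ξ, η⟫_ℂ := by
  rw [MeasurableField.L2.inner_def, ← setIntegral_univ,
    Ω.setIntegral_inner_Lam u MeasurableSet.univ, h, ContinuousLinearMap.id_apply]

/-- `Λ` as an isometry, when `Ω̃(ℝ) = 1`. -/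
noncomputable def LamIsometry (h : Ω.toFun Set.univ = ContinuousLinearMap.id ℂ N) :
    N →ₗᵢ[ℂ] (Ω.field u).L2 :=
  (Ω.Lam u : N →ₗ[ℂ] (Ω.field u).L2).isometryOfInner (Ω.inner_Lam u h)

/-- This translates the divergence hypothesis, stated for `d(ξ, Ω̃ξ)`, into a statement about the
section `Λξ`. -/
theorem scalarMeasure_eq_withDensity (ξ : N) :
    Ω.scalarMeasure ξ = (Ω.control u).withDensity fun t => ‖(Ω.Lam u ξ).fn t‖ₑ ^ 2 := by
  refine Measure.ext fun B hB => ?_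
  rw [scalarMeasure_apply _ _ hB, withDensity_apply _ hB, ← Ω.setIntegral_inner_Lam u hB,
    MeasurableField.integral_inner_self]
  have hi := (Ω.field u).integrable_inner (Ω.Lam u ξ).fn_mem (Ω.Lam u ξ).fn_mem
  refine (ofReal_integral_eq_lintegral_ofReal ?_ (ae_of_all _ fun t => by positivity)).trans ?_
  · have := hi.re.integrableOn (s := B)
    simpa [inner_self_eq_norm_sq_to_K, ← Complex.ofReal_pow, IntegrableOn] using this
  · simp [ENNReal.ofReal_pow, ofReal_norm]

/-- `∫ (1 + t²) d(ξ, Ω̃ ξ)` is finite if `Λξ` is the class of an element of the model space. -/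
theorem lintegral_scalarMeasure_lt_top {ξ : N} {G : Ω.ModelSpace u}
    (h : ∀ᵐ t ∂(Ω.control u), (Ω.Lam u ξ).fn t = G.fn t) :
    ∫⁻ t, ENNReal.ofReal (1 + t ^ 2) ∂(Ω.scalarMeasure ξ) < ⊤ := by
  have hm : AEMeasurable (fun t => ‖(Ω.Lam u ξ).fn t‖ₑ ^ 2) (Ω.control u) :=
    ((Ω.field u).aemeasurable_enorm (Ω.Lam u ξ).fn_mem.1).pow_const 2
  have hG := G.fn_mem.2
  rw [lintegral_withDensity_eq_lintegral_mul₀ measurable_weight.aemeasurable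
    ((((Ω.modelField u).aemeasurable_enorm G.fn_mem.1).pow_const 2).mono_ac
      (Ω.control_absolutelyContinuous u))] at hG
  rw [Ω.scalarMeasure_eq_withDensity u,
    lintegral_withDensity_eq_lintegral_mul₀ hm (by fun_prop)]
  refine lt_of_eq_of_lt (lintegral_congr_ae ?_) hG
  filter_upwards [h] with t ht
  simp only [Pi.mul_apply, ht, weight]
  rw [mul_comm]

/-! ### The range of the deficiency map. -/

theorem deficiencyMap_injective (h : Ω.toFun Set.univ = ContinuousLinearMap.id ℂ N) {z : ℂ}
    (hz : z.im ≠ 0) : Function.Injective (Ω.deficiencyMap u hz) :=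
  (Ω.resolventEquiv u hz).injective.comp (Ω.LamIsometry u h).injective

/-- An isometry from the complete space `N` has closed range, and the homeomorphism given by `(t -
z)⁻¹` preserves closedness. -/
theorem isClosed_range_deficiencyMap (h : Ω.toFun Set.univ = ContinuousLinearMap.id ℂ N) {z : ℂ}
    (hz : z.im ≠ 0) : IsClosed ((Ω.deficiencyMap u hz).range : Set (Ω.ModelSpace u)) := by
  have h1 : IsClosed (Set.range (Ω.LamIsometry u h)) :=
    (Ω.LamIsometry u h).isometry.isClosedEmbedding.isClosed_range
  have h2 := (Ω.resolventEquiv u hz).toHomeomorph.isClosedMap _ h1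
  rw [← Set.range_comp] at h2
  exact h2

theorem closure_span_resolventVectors (h : Ω.toFun Set.univ = ContinuousLinearMap.id ℂ N) {z : ℂ}
    (hz : z.im ≠ 0) : (Submodule.span ℂ (Ω.resolventVectors u z)).topologicalClosure =
      (Ω.deficiencyMap u hz).range := by
  have hspan : Submodule.span ℂ (Ω.resolventVectors u z) =
      (Submodule.span ℂ (Set.range u)).map (Ω.deficiencyMap u hz : N →ₗ[ℂ] Ω.ModelSpace u) := by
    rw [resolventVectors_eq_range, Submodule.map_span, ← Set.range_comp]
    rfl
  apply le_antisymm
  · refine Submodule.topologicalClosure_minimal _ ?_ (Ω.isClosed_range_deficiencyMap u h hz)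
    rw [hspan]
    exact LinearMap.map_le_range
  · rw [hspan]
    rintro _ ⟨ξ, rfl⟩
    have hξ : ξ ∈ closure (Submodule.span ℂ (Set.range u) : Set N) :=
      (Submodule.dense_iff_topologicalClosure_eq_top).2 u.dense_span ξ
    -- By continuity, density of the span of the basis in `N` passes to its image in the range.
    exact image_closure_subset_closure_image (Ω.deficiencyMap u hz).continuous ⟨ξ, hξ, rfl⟩

/-! ### Density of the domain. -/

theorem dense_restrictedOp (h : Ω.toFun Set.univ = ContinuousLinearMap.id ℂ N)
    (h_inf : ∀ ξ : N, ξ ≠ 0 → ∫⁻ t, ENNReal.ofReal (1 + t ^ 2) ∂(Ω.scalarMeasure ξ) = ⊤) :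
    Dense ((Ω.restrictedOp u).domain : Set (Ω.ModelSpace u)) := by
  have hz : Complex.I.im ≠ 0 := by simp
  rw [Submodule.dense_iff_topologicalClosure_eq_top, Submodule.topologicalClosure_eq_top_iff,
    Submodule.eq_bot_iff]
  intro G hG
  have h1 : Ω.modelResolvent u hz G ∈ (Ω.deficiencyMap u hz).range := by
    have hc : (Ω.deficiencyMap u hz).rangeᗮᗮ = (Ω.deficiencyMap u hz).range := by
      rw [Submodule.orthogonal_orthogonal_eq_closure]
      exact IsClosed.submodule_topologicalClosure_eq (Ω.isClosed_range_deficiencyMap u h hz)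
    rw [← hc, Submodule.mem_orthogonal]
    intro F hF
    -- Moving the resolvent across gives `(F, R(z)G) = (R(z̄)F, G)`, and `R(z̄)F` belongs to the
    -- restricted domain, to which `G` is orthogonal.
    rw [← inner_conj_symm, ← Ω.inner_modelResolvent u hz (conj_im_ne_zero hz), inner_conj_symm]
    exact (Submodule.mem_orthogonal _ _).1 hG _ (Ω.modelResolvent_mem_restrictedOp u hz hF)
  obtain ⟨ξ, hξ⟩ := h1
  -- The nonvanishing factor `(t - z)⁻¹` cancels from `D_z ξ = R(z)G`, so `Λξ` has a representative
  -- of finite model norm.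
  have h2 : ∀ᵐ t ∂((Ω.control u).withDensity weight), (Ω.Lam u ξ).fn t = G.fn t := by
    filter_upwards [Ω.fn_deficiencyMap u hz ξ, Ω.fn_modelResolvent u hz G] with t h1 h2
    rw [← hξ] at h2
    exact smul_right_injective _ (inv_ne_zero (ofReal_sub_ne_zero hz t)) (h1.symm.trans h2)
  have h3 : ξ = 0 := by
    by_contra hne
    exact (Ω.lintegral_scalarMeasure_lt_top u
      ((Ω.control_absolutelyContinuous u).ae_le h2)).ne (h_inf ξ hne)
  apply MeasurableField.L2.ext_ae
  have h4 := (withDensity_absolutelyContinuous (Ω.control u) weight).ae_le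
    (MeasurableField.L2.fn_zero (M := Ω.field u))
  rw [h3, map_zero] at h2
  filter_upwards [h2, h4, MeasurableField.L2.fn_zero (M := Ω.modelField u)] with t h2 h4 h5
  rw [← h2, h4, h5]

/-! ### The kernel of the adjoint and its dimension. -/

theorem kerShift_adjoint_restrictedOp (h : Ω.toFun Set.univ = ContinuousLinearMap.id ℂ N)
    (hd : Dense ((Ω.restrictedOp u).domain : Set (Ω.ModelSpace u))) {z : ℂ} (hz : z.im ≠ 0) :
    kerShift (Ω.restrictedOp u).adjoint z = (Ω.deficiencyMap u hz).range := by
  have hc : (Ω.deficiencyMap u hz).rangeᗮᗮ = (Ω.deficiencyMap u hz).range := by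
    rw [Submodule.orthogonal_orthogonal_eq_closure]
    exact IsClosed.submodule_topologicalClosure_eq (Ω.isClosed_range_deficiencyMap u h hz)
  rw [← hc]
  ext G
  constructor
  · rintro ⟨G, hG, rfl⟩
    have hG' : (Ω.restrictedOp u).adjoint G = z • (G : Ω.ModelSpace u) := sub_eq_zero.1 hG
    rw [Submodule.mem_orthogonal]
    intro F hF
    -- Every `F` in `(ran D_z)ᗮ` equals `(Ĥ - z̄)R(z̄)F` with `R(z̄)F` in the restricted domain, so
    -- pairing the eigenvector equation with `R(z̄)F` yields `(G, F) = 0`.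
    have h1 := (Ω.restrictedOp u).adjoint_isFormalAdjoint hd G
      ⟨_, Ω.modelResolvent_mem_restrictedOp u hz hF⟩
    have h2 := Ω.modelOp_sub_modelResolvent u (conj_im_ne_zero hz) F
    rw [restrictedOp_apply, hG', inner_smul_left, ← inner_smul_right, eq_comm,
      ← sub_eq_zero, ← inner_sub_right] at h1
    rw [← inner_conj_symm, map_eq_zero]
    simp only [h2] at h1
    exact h1
  · intro hG
    -- The vector `z • G` represents the functional defining the adjoint at `G`: this gives both
    -- membership in its domain and the eigenvalue equation.
    have h1 : ∀ F : (Ω.restrictedOp u).domain,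
        ⟪z • G, (F : Ω.ModelSpace u)⟫_ℂ = ⟪G, Ω.restrictedOp u F⟫_ℂ := by
      intro F
      have h2 := (Ω.mem_restrictedDomain_iff u hz ⟨F, F.2.2⟩).1 F.2.1
      have h3 := (Submodule.mem_orthogonal' _ _).1 hG _ h2
      rw [inner_sub_right, sub_eq_zero] at h3
      rw [restrictedOp_apply, h3, inner_smul_left, inner_smul_right]
    have h4 : G ∈ (Ω.restrictedOp u).adjoint.domain :=
      LinearPMap.mem_adjoint_domain_of_exists _ ⟨_, h1⟩
    refine ⟨⟨G, h4⟩, ?_, rfl⟩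
    refine sub_eq_zero.2 ?_
    exact LinearPMap.adjoint_apply_eq hd _ h1

/-- The deficiency map is a linear bijection of `N` onto the kernel, so the algebraic ranks agree;
the lift, needed because the two spaces may live in different universes, is invisible in `ℕ∞`. -/
theorem hilbertDim_kerShift (h : Ω.toFun Set.univ = ContinuousLinearMap.id ℂ N)
    (hd : Dense ((Ω.restrictedOp u).domain : Set (Ω.ModelSpace u))) {z : ℂ} (hz : z.im ≠ 0) :
    hilbertDim (kerShift (Ω.restrictedOp u).adjoint z) = hilbertDim N := by
  rw [Ω.kerShift_adjoint_restrictedOp u h hd hz, hilbertDim, hilbertDim]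
  have e := LinearEquiv.ofInjective (Ω.deficiencyMap u hz : N →ₗ[ℂ] Ω.ModelSpace u)
    (Ω.deficiencyMap_injective u h hz)
  have h1 := congrArg Cardinal.toENat e.lift_rank_eq
  rw [Cardinal.toENat_lift, Cardinal.toENat_lift] at h1
  exact h1.symm

end PositiveOperatorMeasure

theorem theoremt3p4 {N : Type*} [NormedAddCommGroup N] [InnerProductSpace ℂ N] [CompleteSpace N]
    {I : Set ℕ} (u : HilbertBasis I ℂ N) (Ωtilde : PositiveOperatorMeasure N)
    (h_norm : Ωtilde.toFun Set.univ = ContinuousLinearMap.id ℂ N)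
    (h_inf : ∀ ξ : N, ξ ≠ 0 →
      ∫⁻ t, ENNReal.ofReal (1 + t ^ 2) ∂(Ωtilde.scalarMeasure ξ) = ⊤) :
    Dense ((Ωtilde.restrictedOp u).domain : Set (Ωtilde.ModelSpace u)) ∧
    (Ωtilde.restrictedOp u).IsFormalAdjoint (Ωtilde.restrictedOp u) ∧
    (Ωtilde.restrictedOp u).IsClosed ∧
    deficiencyIndices (Ωtilde.restrictedOp u) = (hilbertDim N, hilbertDim N) ∧
    ∀ z : ℂ, z.im ≠ 0 →
      kerShift (Ωtilde.restrictedOp u).adjoint z =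
        (Submodule.span ℂ (Ωtilde.resolventVectors u z)).topologicalClosure := by
  have hd := Ωtilde.dense_restrictedOp u h_norm h_inf
  refine ⟨hd, Ωtilde.restrictedOp_isFormalAdjoint u, Ωtilde.restrictedOp_isClosed u, ?_, ?_⟩
  · rw [deficiencyIndices, Ωtilde.hilbertDim_kerShift u h_norm hd (by simp),
      Ωtilde.hilbertDim_kerShift u h_norm hd (by simp)]
  · intro z hz
    rw [Ωtilde.kerShift_adjoint_restrictedOp u h_norm hd hz,
      Ωtilde.closure_span_resolventVectors u h_norm hz]
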